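/- **Setting.** Let $m\ge 1$, $n,r\ge 0$, and let $P(\lambda)=\sum_{j=0}^m\lambda^jA_j$ with $A_j\in\mathbb C^{n\times n}$, $A_m\neq0$. A *realization* of a rational matrix $G(\lambda)$ of size $r$ is a representation $G(\lambda)=P(\lambda)+C(\lambda E-A)^{-1}B$ with a matrix polynomial $P$ and constant matrices $A,E\in\mathbb C^{r\times r}$, $B$, $C$, with $E$ nonsingular; it is *minimal* if $r$ is the smallest size among all realizations of $G(\lambda)$. Its system matrix is $\mathcal S(\lambda)=\begin{bmatrix}P(\lambda)&C\\B&A-\lambda E\end{bmatrix}$, with transfer function $G(\lambda)$; it is *irreducible* if the realization is minimal. **Rosenbrock strong linearization.** An irreducible system matrix $\mathbb L(\lambda)=\begin{bmatrix}X_1-\lambda Y_1&C_1\\B_1&H-\lambda K\end{bmatrix}$ of order $mn+r$, with $X_1,Y_1\in\mathbb C^{mn\times mn}$, $H,K\in\mathbb C^{r\times r}$, $K$ nonsingular, and transfer function $\mathbb G(\lambda)=X_1-\lambda Y_1+C_1(\lambda K-H)^{-1}B_1$, is a Rosenbrock strong linearization of $G(\lambda)=P(\lambda)+C(\lambda E-A)^{-1}B$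 if (a) $\operatorname{diag}(U(\lambda),U_0)\,\mathbb L(\lambda)\,\operatorname{diag}(V(\lambda),V_0)=\operatorname{diag}(I_{(m-1)n},\mathcal S(\lambda))$ for some unimodular $mn\times mn$ matrix polynomials $U,V$ and nonsingular $U_0,V_0\in\mathbb C^{r\times r}$; and (b) $\mathcal O_\ell(\lambda)\,\lambda^{-1}\mathbb G(\lambda)\,\mathcal O_r(\lambda)=\operatorname{diag}(I_{(m-1)n},\lambda^{-m}G(\lambda))$ for some biproper rational matrices $\mathcal O_\ell,\mathcal O_r$ (those tending to a nonsingular constant matrix as $\lambda\to\infty$). **Elementary matrices.** For $X\in\mathbb C^{n\times n}$ put $M_0(X)=\operatorname{diag}(I_{(m-1)n},X)$, $M_{-m}(X)=\operatorname{diag}(X,I_{(m-1)n})$, and for $1\le i\le m-1$ $$M_i(X)=\operatorname{diag}\Big(I_{(m-i-1)n},\begin{bmatrix}X&I_n\\I_n&0\end{bmatrix},I_{(i-1)n}\Big),\qquad M_{-i}(X)=\operatorname{diag}\Big(I_{(m-i-1)n},\begin{bmatrix}0&I_n\\I_n&X\end{bmatrix},I_{(i-1)n}\Big).$$ Put $M_i^P=M_i(-A_i)$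 for $0\le i\le m-1$, $M_i^P=M_i(A_{-i})$ for $-m\le i\le-1$, $\mathbb M_i(X)=\operatorname{diag}(M_i(X),I_r)$, $\mathbb M_i^P=\operatorname{diag}(M_i^P,I_r)$, and $$\mathbb M^{\mathcal S}_0=\begin{bmatrix}M_0^P&-e_m\otimes C\\-e_m^T\otimes B&-A\end{bmatrix},\quad \mathbb M^{\mathcal S}_{-m}=\operatorname{diag}(M^P_{-m},-E),\quad \mathbb M^{\mathcal S}_i=\operatorname{diag}(M_i^P,I_r),\quad \mathbb M^{\mathcal S}_{-i}=(\mathbb M^{\mathcal S}_i)^{-1}\ (1\le i\le m-1),$$ where $e_k$ is the $k$-th column of $I_m$. For an index tuple $\mathbf t=(t_1,\dots,t_k)$ with entries in $\{-m,\dots,m-1\}$ and a matrix assignment $\mathcal X=(X_1,\dots,X_k)$ of $n\times n$ matrices, $M_{\mathbf t}(\mathcal X)=M_{t_1}(X_1)\cdots M_{t_k}(X_k)$; similarly $\mathbb M_{\mathbf t}(\mathcal X)$, $M^P_{\mathbf t}$, $\mathbb M^P_{\mathbf t}$, $\mathbb M^{\mathcal S}_{\mathbf t}$. The assignment is *nonsingular*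 if the matrices at the positions of $\mathbf t$ occupied by $0$ and $-m$ are nonsingular. Reversal of a tuple is denoted $rev$, and $\mathbf t+k$ is the entrywise translate. **Index tuples.** $(k:l)$ is the string $(k,k+1,\dots,l)$, empty if $k>l$. The *simple admissible tuple* of $\{0:h\}$ is $(h-1:h,\,h-3:h-2,\dots,\,p+1:p+2,\,0:p)$, where $p\in\{0,1\}$ has the parity of $h$; its *symmetric complement* is $(h-1,h-3,\dots,1)$ if $p=0$ (empty if $h=0$) and $(h-1,h-3,\dots,2,0)$ if $p=1$. A tuple is *in canonical form for $h$* if it is $(a_1:h-2,\,a_2:h-4,\dots,\,a_{\lfloor h/2\rfloor}:h-2\lfloor h/2\rfloor)$ with integers $a_i\ge0$. For a tuple $\beta$ containing $0$, $i_0(\beta)$ is the largest $s\ge 0$ such that $(s,s-1,\dots,1,0)$ is a subtuple (not necessarily contiguous) of $\beta$. **The pencils.** Let $0\le h\le m-1$. Let $\mathbf w$ and $\mathbf v+m$ be the simple admissible tuples of $\{0:h\}$ and $\{0:m-h-1\}$, with symmetric complements $\mathbf c_w$ and $\mathbf c_v+m$. Let $\mathbf t_w$ and $\mathbf t_v+m$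 be in canonical form for $h$ and $m-h-1$, and let $\mathcal X,\mathcal Y$ be nonsingular matrix assignments for $\mathbf t_w,\mathbf t_v$. Define $$L_P(h,\mathbf t_w,\mathbf t_v,\mathcal X,\mathcal Y)=M_{(\mathbf t_v,\mathbf t_w)}(\mathcal Y,\mathcal X)\,(\lambda M^P_{\mathbf v}-M^P_{\mathbf w})\,M^P_{(\mathbf c_w,\mathbf c_v)}\,M_{(rev\,\mathbf t_w,rev\,\mathbf t_v)}(rev\,\mathcal X,rev\,\mathcal Y),$$ $$\mathbb L_{\mathcal S}(h,\mathbf t_w,\mathbf t_v,\mathcal X,\mathcal Y)=\mathbb M_{(\mathbf t_v,\mathbf t_w)}(\mathcal Y,\mathcal X)\,(\lambda \mathbb M^{\mathcal S}_{\mathbf v}-\mathbb M^{\mathcal S}_{\mathbf w})\,\mathbb M^P_{(\mathbf c_w,\mathbf c_v)}\,\mathbb M_{(rev\,\mathbf t_w,rev\,\mathbf t_v)}(rev\,\mathcal X,rev\,\mathcal Y).$$ **Statement.** Let $G(\lambda)\in\mathbb C(\lambda)^{n\times n}$ be symmetric, $G(\lambda)^T=G(\lambda)$, with a minimal realization $G(\lambda)=P(\lambda)+B^T(\lambda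 E-A)^{-1}B$ in which $A$ and $E$ are symmetric and $E$ is nonsingular, and let $\mathcal S(\lambda)=\begin{bmatrix}P(\lambda)&B^T\\B&A-\lambda E\end{bmatrix}$. Let $0\le h\le m-1$ be even, and let $\mathbf t_w,\mathbf t_v,\mathcal X,\mathcal Y$ be as above with all matrices in $\mathcal X$ and $\mathcal Y$ symmetric. Put $\alpha=i_0(\mathbf t_w,\mathbf w)$, $L(\lambda)=L_P(h,\mathbf t_w,\mathbf t_v,\mathcal X,\mathcal Y)$ and $\mathbb L(\lambda)=\mathbb L_{\mathcal S}(h,\mathbf t_w,\mathbf t_v,\mathcal X,\mathcal Y)$. Then $$\mathbb L(\lambda)=\begin{bmatrix}L(\lambda)&e_{m-\alpha}\otimes B^T\\ e_{m-\alpha}^T\otimes B&A-\lambda E\end{bmatrix},$$ and $\mathbb L(\lambda)$ is symmetric. If $m$ is odd, then $\mathbb L(\lambda)$ is a (symmetric) Rosenbrock strong linearization of $G(\lambda)$. If $m$ is even and $A_m$ is nonsingular, then $\mathbb L(\lambda)$ is a (symmetric) Rosenbrock strong linearization of $G(\lambda)$. Moreover, the transfer function $\mathbb G(\lambda)=L(\lambda)+(e_{m-\alpha}\otimes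 B^T)(\lambda E-A)^{-1}(e_{m-\alpha}^T\otimes B)$ of $\mathbb L(\lambda)$ is symmetric. -/

import Mathlib

open Matrix Polynomial Filter Topology

namespace RosenbrockGFPR

/-! ### Realizations, system matrices, Rosenbrock strong linearizations -/

/-- A complex matrix viewed as a constant matrix polynomial. -/
noncomputable def cPoly {ι κ : Type} (M : Matrix ι κ ℂ) : Matrix ι κ ℂ[X] :=
  M.map Polynomial.C

/-- A complex matrix viewed as a constant rational matrix. -/
noncomputable def cRat {ι κ : Type} (M : Matrix ι κ ℂ) : Matrix ι κ (RatFunc ℂ) :=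
  M.map RatFunc.C

/-- A matrix polynomial viewed as a rational matrix. -/
noncomputable def polyToRat {ι κ : Type} (M : Matrix ι κ ℂ[X]) : Matrix ι κ (RatFunc ℂ) :=
  M.map (algebraMap ℂ[X] (RatFunc ℂ))

/-- The rational matrix `P(λ) + C (λ E - A)⁻¹ B`. -/
noncomputable def transferFunction {ι : Type} {r : ℕ} (P : Matrix ι ι ℂ[X])
    (A : Matrix (Fin r) (Fin r) ℂ) (B : Matrix (Fin r) ι ℂ) (C : Matrix ι (Fin r) ℂ)
    (E : Matrix (Fin r) (Fin r) ℂ) : Matrix ι ι (RatFunc ℂ) :=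
  polyToRat P + cRat C * ((RatFunc.X : RatFunc ℂ) • cRat E - cRat A)⁻¹ * cRat B

/-- `G(λ) = P(λ) + C (λ E - A)⁻¹ B` is a realization of `G(λ)` of size `r`
(with `E` nonsingular). -/
def IsRealization {ι : Type} {r : ℕ} (G : Matrix ι ι (RatFunc ℂ)) (P : Matrix ι ι ℂ[X])
    (A : Matrix (Fin r) (Fin r) ℂ) (B : Matrix (Fin r) ι ℂ) (C : Matrix ι (Fin r) ℂ)
    (E : Matrix (Fin r) (Fin r) ℂ) : Prop :=
  E.det ≠ 0 ∧ G = transferFunction P A B C E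

/-- A realization is minimal if the size of the pencil `λ E - A` is the smallest among all
realizations of `G(λ)`. The associated system matrix is then called irreducible. -/
def IsMinimalRealization {ι : Type} {r : ℕ} (G : Matrix ι ι (RatFunc ℂ)) (P : Matrix ι ι ℂ[X])
    (A : Matrix (Fin r) (Fin r) ℂ) (B : Matrix (Fin r) ι ℂ) (C : Matrix ι (Fin r) ℂ)
    (E : Matrix (Fin r) (Fin r) ℂ) : Prop :=
  IsRealization G P A B C E ∧
    ∀ (r' : ℕ) (P' : Matrix ι ι ℂ[X]) (A' : Matrix (Fin r') (Fin r') ℂ)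
      (B' : Matrix (Fin r') ι ℂ) (C' : Matrix ι (Fin r') ℂ) (E' : Matrix (Fin r') (Fin r') ℂ),
      IsRealization G P' A' B' C' E' → r ≤ r'

/-- The system matrix `[P(λ), C; B, A - λ E]`. -/
noncomputable def systemMatrix {ι : Type} {r : ℕ} (P : Matrix ι ι ℂ[X])
    (A : Matrix (Fin r) (Fin r) ℂ) (B : Matrix (Fin r) ι ℂ) (C : Matrix ι (Fin r) ℂ)
    (E : Matrix (Fin r) (Fin r) ℂ) : Matrix (ι ⊕ Fin r) (ι ⊕ Fin r) ℂ[X] :=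
  fromBlocks P (cPoly C) (cPoly B) (cPoly A - (Polynomial.X : ℂ[X]) • cPoly E)

/-- A matrix polynomial whose determinant is a nonzero constant. -/
def IsUnimodular {ι : Type} [Fintype ι] [DecidableEq ι] (U : Matrix ι ι ℂ[X]) : Prop :=
  ∃ c : ℂ, c ≠ 0 ∧ U.det = Polynomial.C c

/-- A rational matrix `F(λ)` that tends to a nonsingular constant matrix as `λ → ∞`. -/
def IsBiproper {ι : Type} [Fintype ι] [DecidableEq ι] (F : Matrix ι ι (RatFunc ℂ)) : Prop :=
  ∃ D : Matrix ι ι ℂ, D.det ≠ 0 ∧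
    Tendsto (fun z : ℂ => F.map (RatFunc.eval (RingHom.id ℂ) z)) (Bornology.cobounded ℂ) (𝓝 D)

/-- The `mn × mn` matrix `diag(I_{(m-1)n}, X)`. Here and below, an `mn × mn` matrix is indexed by
pairs (block number, position in the block); the block number `k = 1, …, m`
corresponds to the element `k - 1` of `Fin m`. -/
def diagLast {R : Type} [Zero R] [One R] {n : ℕ} (m : ℕ) (X : Matrix (Fin n) (Fin n) R) :
    Matrix (Fin m × Fin n) (Fin m × Fin n) R :=
  Matrix.of fun p q =>
    if p.1 = q.1 then (if (p.1 : ℕ) + 1 = m then X else 1) p.2 q.2 else 0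

/-- The `mn × r` matrix `e_k ⊗ C`, where `e_k` is the `k`-th column of `I_m`, `1 ≤ k ≤ m`. -/
def colKron {n r : ℕ} (m : ℕ) (k : ℤ) (C : Matrix (Fin n) (Fin r) ℂ) :
    Matrix (Fin m × Fin n) (Fin r) ℂ :=
  Matrix.of fun p j => if ((p.1 : ℕ) : ℤ) + 1 = k then C p.2 j else 0

/-- The `r × mn` matrix `e_kᵀ ⊗ B`, where `e_k` is the `k`-th column of `I_m`, `1 ≤ k ≤ m`. -/
def rowKron {n r : ℕ} (m : ℕ) (k : ℤ) (B : Matrix (Fin r) (Fin n) ℂ) :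
    Matrix (Fin r) (Fin m × Fin n) ℂ :=
  Matrix.of fun i q => if ((q.1 : ℕ) : ℤ) + 1 = k then B i q.2 else 0

/-- `𝕃` is a Rosenbrock strong linearization of `G(λ) = P(λ) + C (λ E - A)⁻¹ B`
(that is, of its system matrix), `m` being the degree of `P(λ)`.
In (a), the right-hand side is `diag(I_{(m-1)n}, 𝒮(λ))` where `𝒮(λ) = [P(λ), C; B, A - λ E]`
occupies the `m`-th block and the last `r` coordinates. -/
def IsRosenbrockStrongLinearization {m n r : ℕ}
    (𝕃 : Matrix ((Fin m × Fin n) ⊕ Fin r) ((Fin m × Fin n) ⊕ Fin r) ℂ[X])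
    (G : Matrix (Fin n) (Fin n) (RatFunc ℂ)) (P : Matrix (Fin n) (Fin n) ℂ[X])
    (A : Matrix (Fin r) (Fin r) ℂ) (B : Matrix (Fin r) (Fin n) ℂ)
    (C : Matrix (Fin n) (Fin r) ℂ) (E : Matrix (Fin r) (Fin r) ℂ) : Prop :=
  ∃ (X₁ Y₁ : Matrix (Fin m × Fin n) (Fin m × Fin n) ℂ)
    (C₁ : Matrix (Fin m × Fin n) (Fin r) ℂ) (B₁ : Matrix (Fin r) (Fin m × Fin n) ℂ)
    (H K : Matrix (Fin r) (Fin r) ℂ)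
    (𝔾 : Matrix (Fin m × Fin n) (Fin m × Fin n) (RatFunc ℂ)),
    -- the form of `𝕃`, and its transfer function
    𝕃 = systemMatrix (cPoly X₁ - (Polynomial.X : ℂ[X]) • cPoly Y₁) H B₁ C₁ K ∧
    𝔾 = transferFunction (cPoly X₁ - (Polynomial.X : ℂ[X]) • cPoly Y₁) H B₁ C₁ K ∧
    -- `K` is nonsingular and `𝕃` is irreducible
    IsMinimalRealization 𝔾 (cPoly X₁ - (Polynomial.X : ℂ[X]) • cPoly Y₁) H B₁ C₁ K ∧
    -- (a)
    (∃ (U V : Matrix (Fin m × Fin n) (Fin m × Fin n) ℂ[X]) (U₀ V₀ : Matrix (Fin r) (Fin r) ℂ),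
      IsUnimodular U ∧ IsUnimodular V ∧ U₀.det ≠ 0 ∧ V₀.det ≠ 0 ∧
      fromBlocks U 0 0 (cPoly U₀) * 𝕃 * fromBlocks V 0 0 (cPoly V₀) =
        systemMatrix (diagLast m P) A (rowKron m m B) (colKron m m C) E) ∧
    -- (b)
    (∃ Oₗ Oᵣ : Matrix (Fin m × Fin n) (Fin m × Fin n) (RatFunc ℂ),
      IsBiproper Oₗ ∧ IsBiproper Oᵣ ∧
      Oₗ * ((RatFunc.X : RatFunc ℂ)⁻¹ • 𝔾) * Oᵣ =
        diagLast m (((RatFunc.X : RatFunc ℂ)⁻¹ ^ m) • G))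

/-! ### Elementary matrices and Fiedler matrices -/

/-- The matrix polynomial `∑_{j=0}^m λ^j A_j`. -/
noncomputable def matPoly {n : ℕ} (m : ℕ) (a : ℕ → Matrix (Fin n) (Fin n) ℂ) :
    Matrix (Fin n) (Fin n) ℂ[X] :=
  ∑ j ∈ Finset.range (m + 1), (Polynomial.X : ℂ[X]) ^ j • cPoly (a j)

/-- The `(p, q)` block of the elementary matrix `M_i(X)`, for `i ∈ {-m, …, m-1}`
(the identity for other `i`). For `1 ≤ |i| ≤ m-1`, the nontrivial `2 × 2` block part sits in
the blocks numbered `m-i-1` and `m-i` when counting from `0`. -/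
def elemBlock {n : ℕ} (m : ℕ) (i : ℤ) (X : Matrix (Fin n) (Fin n) ℂ) (p q : Fin m) :
    Matrix (Fin n) (Fin n) ℂ :=
  if i = 0 then
    -- diag(I_{(m-1)n}, X)
    if p = q then (if (p : ℕ) + 1 = m then X else 1) else 0
  else if i = -(m : ℤ) then
    -- diag(X, I_{(m-1)n})
    if p = q then (if (p : ℕ) = 0 then X else 1) else 0
  else if i.natAbs < m then
    -- diag(I, [X, I; I, 0], I) if i > 0,  diag(I, [0, I; I, X], I) if i < 0
    if (p : ℕ) + i.natAbs + 1 = m ∧ (q : ℕ) + i.natAbs + 1 = m then (if 0 < i then X else 0)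
    else if (p : ℕ) + i.natAbs + 1 = m ∧ (q : ℕ) + i.natAbs = m then 1
    else if (p : ℕ) + i.natAbs = m ∧ (q : ℕ) + i.natAbs + 1 = m then 1
    else if (p : ℕ) + i.natAbs = m ∧ (q : ℕ) + i.natAbs = m then (if 0 < i then 0 else X)
    else if p = q then 1 else 0
  else
    if p = q then 1 else 0

/-- The `mn × mn` elementary matrix `M_i(X)`. -/
def elemM {n : ℕ} (m : ℕ) (i : ℤ) (X : Matrix (Fin n) (Fin n) ℂ) :
    Matrix (Fin m × Fin n) (Fin m × Fin n) ℂ :=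
  Matrix.of fun p q => elemBlock m i X p.1 q.1 p.2 q.2

/-- The Fiedler matrix `M_i^P`: it is `M_i(-A_i)` if `i ≥ 0` and `M_i(A_{-i})` if `i < 0`. -/
noncomputable def fiedlerP {n : ℕ} (m : ℕ) (a : ℕ → Matrix (Fin n) (Fin n) ℂ) (i : ℤ) :
    Matrix (Fin m × Fin n) (Fin m × Fin n) ℂ :=
  elemM m i (if 0 ≤ i then -a i.natAbs else a i.natAbs)

/-- `diag(M, I_r)`. -/
def extendOne {m n : ℕ} (r : ℕ) (M : Matrix (Fin m × Fin n) (Fin m × Fin n) ℂ) :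
    Matrix ((Fin m × Fin n) ⊕ Fin r) ((Fin m × Fin n) ⊕ Fin r) ℂ :=
  fromBlocks M 0 0 1

/-- The Fiedler matrices `𝕄_i^𝒮` of the system matrix `𝒮(λ) = [P(λ), C; B, A - λ E]`,
`i ∈ {-m, …, m-1}`. -/
noncomputable def fiedlerS {n r : ℕ} (m : ℕ) (a : ℕ → Matrix (Fin n) (Fin n) ℂ)
    (A : Matrix (Fin r) (Fin r) ℂ) (B : Matrix (Fin r) (Fin n) ℂ)
    (C : Matrix (Fin n) (Fin r) ℂ) (E : Matrix (Fin r) (Fin r) ℂ) (i : ℤ) :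
    Matrix ((Fin m × Fin n) ⊕ Fin r) ((Fin m × Fin n) ⊕ Fin r) ℂ :=
  if i = 0 then fromBlocks (fiedlerP m a 0) (-colKron m m C) (-rowKron m m B) (-A)
  else if i = -(m : ℤ) then fromBlocks (fiedlerP m a (-(m : ℤ))) 0 0 (-E)
  else if 0 < i then extendOne r (fiedlerP m a i)
  else (extendOne r (fiedlerP m a (-i)))⁻¹

/-! ### Index tuples -/

/-- The string `(k : l) = (k, k+1, …, l)`, which is empty if `k > l`. -/
def str (k l : ℤ) : List ℤ := (List.range (l - k + 1).toNat).map fun s => k + (s : ℤ)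

/-- The admissible tuple `(h-1:h, h-3:h-2, …, p+1:p+2, 0:p)` of `{0:h}` with index `p`
(for `p ≤ h` and `h - p` even). -/
def admissibleTuple (h p : ℕ) : List ℤ :=
  ((List.range ((h - p) / 2)).flatMap fun k => str ((h : ℤ) - 2 * k - 1) ((h : ℤ) - 2 * k))
    ++ str 0 p

/-- The symmetric complement
`(h-1, h-3, …, p+1, 0:p-1, 0:p-2, …, 0:1, 0)` of the admissible tuple of `{0:h}` with index `p`. -/
def symmComplement (h p : ℕ) : List ℤ :=
  ((List.range ((h - p) / 2)).map fun k => (h : ℤ) - 2 * k - 1)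
    ++ (List.range p).flatMap fun k => str 0 ((p : ℤ) - 1 - k)

/-- The simple admissible tuple of `{0:h}`: its index is `0` or `1`, with the parity of `h`. -/
def simpleTuple (h : ℕ) : List ℤ := admissibleTuple h (h % 2)

/-- The symmetric complement of the simple admissible tuple of `{0:h}`. -/
def simpleComplement (h : ℕ) : List ℤ := symmComplement h (h % 2)

/-- The translate `t + k` of an index tuple. -/
def shift (k : ℤ) (t : List ℤ) : List ℤ := t.map (· + k)

/-- `t` is in canonical form for `h`:
`t = (a₁ : h-2, a₂ : h-4, …, a_{⌊h/2⌋} : h - 2⌊h/2⌋)` with `a_i ≥ 0`. -/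
def IsCanonical (h : ℕ) (t : List ℤ) : Prop :=
  ∃ c : ℕ → ℕ, t = (List.range (h / 2)).flatMap fun k => str (c k) ((h : ℤ) - 2 * ((k : ℤ) + 1))

/-- The number `i_t(α)` of consecutive inversions of `α` at `t`: the largest `s` for which
`(t+s, …, t+1, t)` is a subtuple of `α`, and `-1` if `t` does not occur in `α`. -/
def inversionsAt (t : ℤ) (α : List ℤ) : ℤ :=
  if t ∈ α then (Nat.findGreatest (fun s => (str t (t + s)).reverse.Sublist α) α.length : ℤ)
  else -1

/-- `𝒳` is a nonsingular matrix assignment for the index tuple `t`: one matrix for each position,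
nonsingular at the positions occupied by the indices `0` and `-m`. -/
def IsNonsingularAssignment {n : ℕ} (m : ℕ) (t : List ℤ) (𝒳 : List (Matrix (Fin n) (Fin n) ℂ)) :
    Prop :=
  𝒳.length = t.length ∧ ∀ x ∈ t.zip 𝒳, (x.1 = 0 ∨ x.1 = -(m : ℤ)) → x.2.det ≠ 0

/-! ### The pencils `L_P` and `𝕃_𝒮` -/

/-- `M_t(𝒳) = M_{t₁}(X₁) ⋯ M_{t_k}(X_k)`. -/
def prodM {n : ℕ} (m : ℕ) (t : List ℤ) (𝒳 : List (Matrix (Fin n) (Fin n) ℂ)) :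
    Matrix (Fin m × Fin n) (Fin m × Fin n) ℂ :=
  (List.zipWith (fun i X => elemM m i X) t 𝒳).prod

/-- `M_t^P = M_{t₁}^P ⋯ M_{t_k}^P`. -/
noncomputable def prodP {n : ℕ} (m : ℕ) (a : ℕ → Matrix (Fin n) (Fin n) ℂ) (t : List ℤ) :
    Matrix (Fin m × Fin n) (Fin m × Fin n) ℂ :=
  (t.map (fiedlerP m a)).prod

/-- `𝕄_t(𝒳) = 𝕄_{t₁}(X₁) ⋯ 𝕄_{t_k}(X_k)`, where `𝕄_i(X) = diag(M_i(X), I_r)`. -/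
def prodMM {n : ℕ} (m r : ℕ) (t : List ℤ) (𝒳 : List (Matrix (Fin n) (Fin n) ℂ)) :
    Matrix ((Fin m × Fin n) ⊕ Fin r) ((Fin m × Fin n) ⊕ Fin r) ℂ :=
  (List.zipWith (fun i X => extendOne r (elemM m i X)) t 𝒳).prod

/-- `𝕄_t^P = 𝕄_{t₁}^P ⋯ 𝕄_{t_k}^P`, where `𝕄_i^P = diag(M_i^P, I_r)`. -/
noncomputable def prodPP {n : ℕ} (m r : ℕ) (a : ℕ → Matrix (Fin n) (Fin n) ℂ) (t : List ℤ) :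
    Matrix ((Fin m × Fin n) ⊕ Fin r) ((Fin m × Fin n) ⊕ Fin r) ℂ :=
  (t.map fun i => extendOne r (fiedlerP m a i)).prod

/-- `𝕄_t^𝒮 = 𝕄_{t₁}^𝒮 ⋯ 𝕄_{t_k}^𝒮`. -/
noncomputable def prodSS {n r : ℕ} (m : ℕ) (a : ℕ → Matrix (Fin n) (Fin n) ℂ)
    (A : Matrix (Fin r) (Fin r) ℂ) (B : Matrix (Fin r) (Fin n) ℂ)
    (C : Matrix (Fin n) (Fin r) ℂ) (E : Matrix (Fin r) (Fin r) ℂ) (t : List ℤ) :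
    Matrix ((Fin m × Fin n) ⊕ Fin r) ((Fin m × Fin n) ⊕ Fin r) ℂ :=
  (t.map (fiedlerS m a A B C E)).prod

/-- The pencil `L_P(h, t_w, t_v, 𝒳, 𝒴)`, that is,
`M_{(t_v, t_w)}(𝒴, 𝒳) (λ M_v^P - M_w^P) M_{(c_w, c_v)}^P M_{(rev t_w, rev t_v)}(rev 𝒳, rev 𝒴)`,
where `w` and `v + m` are the simple admissible tuples of `{0:h}` and `{0:m-h-1}`, with symmetric
complements `c_w` and `c_v + m`. -/
noncomputable def pencilP {n : ℕ} (m h : ℕ) (a : ℕ → Matrix (Fin n) (Fin n) ℂ) (tw tv : List ℤ)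
    (𝒳 𝒴 : List (Matrix (Fin n) (Fin n) ℂ)) :
    Matrix (Fin m × Fin n) (Fin m × Fin n) ℂ[X] :=
  cPoly (prodM m (tv ++ tw) (𝒴 ++ 𝒳)) *
    ((Polynomial.X : ℂ[X]) • cPoly (prodP m a (shift (-m) (simpleTuple (m - h - 1))))
      - cPoly (prodP m a (simpleTuple h))) *
    cPoly (prodP m a (simpleComplement h ++ shift (-m) (simpleComplement (m - h - 1)))) *
    cPoly (prodM m (tw.reverse ++ tv.reverse) (𝒳.reverse ++ 𝒴.reverse))

/-- The pencil `𝕃_𝒮(h, t_w, t_v, 𝒳, 𝒴)`, that is,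
`𝕄_{(t_v, t_w)}(𝒴, 𝒳) (λ 𝕄_v^𝒮 - 𝕄_w^𝒮) 𝕄_{(c_w, c_v)}^P 𝕄_{(rev t_w, rev t_v)}(rev 𝒳, rev 𝒴)`,
associated with `𝒮(λ) = [P(λ), C; B, A - λ E]`. -/
noncomputable def pencilS {n r : ℕ} (m h : ℕ) (a : ℕ → Matrix (Fin n) (Fin n) ℂ)
    (A : Matrix (Fin r) (Fin r) ℂ) (B : Matrix (Fin r) (Fin n) ℂ)
    (C : Matrix (Fin n) (Fin r) ℂ) (E : Matrix (Fin r) (Fin r) ℂ) (tw tv : List ℤ)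
    (𝒳 𝒴 : List (Matrix (Fin n) (Fin n) ℂ)) :
    Matrix ((Fin m × Fin n) ⊕ Fin r) ((Fin m × Fin n) ⊕ Fin r) ℂ[X] :=
  cPoly (prodMM m r (tv ++ tw) (𝒴 ++ 𝒳)) *
    ((Polynomial.X : ℂ[X]) • cPoly (prodSS m a A B C E (shift (-m) (simpleTuple (m - h - 1))))
      - cPoly (prodSS m a A B C E (simpleTuple h))) *
    cPoly (prodPP m r a (simpleComplement h ++ shift (-m) (simpleComplement (m - h - 1)))) *
    cPoly (prodMM m r (tw.reverse ++ tv.reverse) (𝒳.reverse ++ 𝒴.reverse))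

end RosenbrockGFPR

open RosenbrockGFPR

/-!
For even `h`, Fiedler matrices whose indices have the same parity commute, and splitting off common
factors turns `M_v^P` and `M_w^P` into `N₀ 𝒪` and `N₀ ℰ`, where `𝒪` is the product of `M_{-m}^P` and
of the odd factors `M_{-i}^P`, `ℰ` is the product of the even factors `M_i^P`, and the symmetric
complements multiply to `D N₀` with `D` equal to `M_{-m}^P` for even `m` and to `I` for odd `m`.
For symmetric data this gives `L_P = N (λ 𝒪 - ℰ) D Nᵀ`, in which `𝒪 D` and `ℰ D` are symmetric. The
off-diagonal blocks of `𝕃_𝒮` are `N (e_m ⊗ C)` and `(e_mᵀ ⊗ B) D Nᵀ`, and the elementary factors of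
`N` move the block `C` from position `m` to position `m - α`.

The block tridiagonal pencil `λ 𝒪 - ℰ` is reduced to `diag(I, P(λ))` by a block column of Horner
shifts of `P`. The same reduction at infinity, with truncations in `λ⁻¹`, applies to the rational
matrix `G` because `C (λ E - A)⁻¹ B` tends to `0` at infinity and only changes the constant
coefficient of `P`.
-/

namespace RosenbrockGFPR

section Locality
variable {ι R : Type*} [DecidableEq ι] [Ring R]

/-- The matrix `Z` agrees with the identity outside the square block indexed by `S`. -/
def IsLocal (S : Set ι) (Z : Matrix ι ι R) : Prop :=
  ∀ p q, p ∉ S ∨ q ∉ S → Z p q = (1 : Matrix ι ι R) p q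

variable [Fintype ι] {S T : Set ι} {Z W : Matrix ι ι R}

theorem IsLocal.sub_one_mul_sub_one (hZ : IsLocal S Z) (hW : IsLocal T W) (h : Disjoint S T) :
    (Z - 1) * (W - 1) = 0 := by
  ext p q
  rw [mul_apply]
  refine Finset.sum_eq_zero fun l _ => ?_
  by_cases hl : l ∈ S
  · rw [Matrix.sub_apply W, hW l q (.inl (h.notMem_of_mem_left hl)), sub_self, mul_zero]
  · rw [Matrix.sub_apply Z, hZ p l (.inr hl), sub_self, zero_mul]

theorem IsLocal.mul_eq (hZ : IsLocal S Z) (hW : IsLocal T W) (h : Disjoint S T) :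
    Z * W = Z + W - 1 := by
  rw [← sub_eq_zero, ← hZ.sub_one_mul_sub_one hW h]
  noncomm_ring

theorem IsLocal.commute (hZ : IsLocal S Z) (hW : IsLocal T W) (h : Disjoint S T) :
    Commute Z W := by
  rw [Commute, SemiconjBy, hZ.mul_eq hW h, hW.mul_eq hZ h.symm, add_comm]

variable {κ : Type*} {N : κ → Matrix ι ι R} {U : κ → Set ι} {t : List κ}

theorem isLocal_prod (hN : ∀ i ∈ t, IsLocal (U i) (N i))
    (ht : t.Pairwise fun i j => Disjoint (U i) (U j)) :
    IsLocal {p | ∃ i ∈ t, p ∈ U i} (t.map N).prod := by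
  induction t with
  | nil => exact fun _ _ _ => rfl
  | cons j t ih =>
    rw [List.forall_mem_cons] at hN
    rw [List.pairwise_cons] at ht
    have hd : Disjoint (U j) {p | ∃ i ∈ t, p ∈ U i} :=
      Set.disjoint_left.2 fun p hp ⟨i, hi, hpi⟩ => (ht.1 i hi).notMem_of_mem_left hp hpi
    intro p q hpq
    simp only [List.mem_cons, Set.mem_ofPred_eq, exists_eq_or_imp, not_or] at hpq
    rw [List.map_cons, List.prod_cons, hN.1.mul_eq (ih hN.2 ht.2) hd, Matrix.sub_apply,
      Matrix.add_apply, hN.1 p q (hpq.imp And.left And.left),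
      ih hN.2 ht.2 p q (hpq.imp And.right And.right), add_sub_cancel_right]

theorem prod_apply_of_mem (hN : ∀ i ∈ t, IsLocal (U i) (N i))
    (ht : t.Pairwise fun i j => Disjoint (U i) (U j)) {i : κ} (hi : i ∈ t) {p : ι}
    (hp : p ∈ U i) (q : ι) : (t.map N).prod p q = N i p q := by
  induction t with
  | nil => simp at hi
  | cons j t ih =>
    rw [List.forall_mem_cons] at hN
    rw [List.pairwise_cons] at ht
    have hd : Disjoint (U j) {p | ∃ i ∈ t, p ∈ U i} :=
      Set.disjoint_left.2 fun p hp ⟨i, hi, hpi⟩ => (ht.1 i hi).notMem_of_mem_left hp hpi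
    rw [List.map_cons, List.prod_cons, hN.1.mul_eq (isLocal_prod hN.2 ht.2) hd, Matrix.sub_apply,
      Matrix.add_apply]
    rcases List.mem_cons.1 hi with rfl | hi
    · rw [isLocal_prod hN.2 ht.2 p q (.inl (hd.notMem_of_mem_left hp)), add_sub_cancel_right]
    · rw [ih hN.2 ht.2 hi, hN.1 p q (.inl ((ht.1 i hi).notMem_of_mem_right hp)),
        add_sub_cancel_left]

end Locality

section Elementary
variable {m n r : ℕ}

/-- The level of the `p`-th of `m` blocks, counted from `0`, is `p.rev = m - 1 - p`: the matrix
`M_i(X)` differs from the identity only in the blocks of levels `|i|` and `|i| - 1`. -/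
def levelSupport (m : ℕ) (i : ℤ) : Set (Fin m) :=
  {p | (p.rev : ℕ) = i.natAbs ∨ (p.rev : ℕ) + 1 = i.natAbs}

/-- Indices at distance at least two in absolute value, so that the corresponding elementary
matrices act on disjoint sets of blocks. -/
def Far (i j : ℤ) : Prop := i.natAbs + 2 ≤ j.natAbs ∨ j.natAbs + 2 ≤ i.natAbs

theorem Far.disjoint {i j : ℤ} (h : Far i j) :
    Disjoint (levelSupport m i) (levelSupport m j) := by
  refine Set.disjoint_left.2 fun p hi hj => ?_
  simp only [levelSupport, Set.mem_ofPred_eq, Far] at hi hj h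
  omega

theorem isLocal_elemBlock (i : ℤ) (X : Matrix (Fin n) (Fin n) ℂ) :
    IsLocal (levelSupport m i) (of (elemBlock m i X)) := by
  intro p q h
  simp only [levelSupport, Set.mem_ofPred_eq, Fin.val_rev] at h
  simp only [of_apply, elemBlock, one_apply, ← Fin.val_inj]
  split_ifs <;> first | rfl | omega

theorem comp_elemBlock (i : ℤ) (X : Matrix (Fin n) (Fin n) ℂ) :
    compRingEquiv (Fin m) (Fin n) ℂ (of (elemBlock m i X)) = elemM m i X := rfl

theorem elemM_commute {i j : ℤ} (X Y : Matrix (Fin n) (Fin n) ℂ) (h : Far i j) :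
    Commute (elemM m i X) (elemM m j Y) :=
  ((isLocal_elemBlock i X).commute (isLocal_elemBlock j Y) h.disjoint).map
    (compRingEquiv (Fin m) (Fin n) ℂ)

theorem elemM_transpose (i : ℤ) (X : Matrix (Fin n) (Fin n) ℂ) :
    (elemM m i X)ᵀ = elemM m i Xᵀ := by
  ext ⟨p, c⟩ ⟨q, d⟩
  have h1 : (1 : Matrix (Fin n) (Fin n) ℂ) d c = (1 : Matrix (Fin n) (Fin n) ℂ) c d :=
    congrFun₂ transpose_one c d
  simp only [elemM, elemBlock, transpose_apply, of_apply]
  split_ifs <;> first | rfl | exact h1 | omega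

theorem elemBlock_natCast_eq_submatrix {i : ℕ} (hi : i ≠ 0) {p₁ p₂ : Fin m}
    (h₁ : (p₁ : ℕ) + i + 1 = m) (h₂ : (p₂ : ℕ) + i = m) (X : Matrix (Fin n) (Fin n) ℂ) :
    of (elemBlock m i X) = (1 + single p₁ p₂ X).submatrix id (Equiv.swap p₁ p₂) := by
  ext1 p q
  have h : p₁ ≠ p₂ := by rintro rfl; omega
  have hp₁ (p : Fin m) : (p : ℕ) + i + 1 = m ↔ p = p₁ := by omega
  have hp₂ (p : Fin m) : (p : ℕ) + i = m ↔ p = p₂ := by omega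
  have hm : ¬ (i : ℤ) = -m := by omega
  have him : i < m := by omega
  simp only [of_apply, elemBlock, submatrix_apply, id, Matrix.add_apply, one_apply, single_apply,
    Equiv.swap_apply_def, Int.natAbs_natCast, Nat.cast_eq_zero, hi, hm, him, hp₁, hp₂]
  grind

theorem elemBlock_neg_natCast_eq_submatrix {i : ℕ} (hi : i ≠ 0) {p₁ p₂ : Fin m}
    (h₁ : (p₁ : ℕ) + i + 1 = m) (h₂ : (p₂ : ℕ) + i = m) (X : Matrix (Fin n) (Fin n) ℂ) :
    of (elemBlock m (-i) X) = (1 + single p₁ p₂ X).submatrix (Equiv.swap p₁ p₂) id := by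
  ext1 p q
  have h : p₁ ≠ p₂ := by rintro rfl; omega
  have hp₁ (p : Fin m) : (p : ℕ) + i + 1 = m ↔ p = p₁ := by omega
  have hp₂ (p : Fin m) : (p : ℕ) + i = m ↔ p = p₂ := by omega
  have hm : ¬ -(i : ℤ) = -m := by omega
  have him : i < m := by omega
  simp only [of_apply, elemBlock, submatrix_apply, id, Matrix.add_apply, one_apply, single_apply,
    Equiv.swap_apply_def, Int.natAbs_neg, Int.natAbs_natCast, neg_eq_zero, Nat.cast_eq_zero, hi,
    hm, him, hp₁, hp₂]
  grind

theorem elemM_mul_elemM_neg {i : ℤ} (h0 : i ≠ 0) (hi : i.natAbs < m)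
    (X : Matrix (Fin n) (Fin n) ℂ) : elemM m i X * elemM m (-i) (-X) = 1 := by
  have key (k : ℕ) (hk : k ≠ 0) (hkm : k < m) (Y : Matrix (Fin n) (Fin n) ℂ) :
      elemM m k Y * elemM m (-k) (-Y) = 1 := by
    have h₁ : ((⟨m - (k + 1), by omega⟩ : Fin m) : ℕ) + k + 1 = m := by simp only; omega
    have h₂ : ((⟨m - k, by omega⟩ : Fin m) : ℕ) + k = m := by simp only; omega
    have h : (1 + single ⟨m - (k + 1), by omega⟩ ⟨m - k, by omega⟩ Y : Matrix (Fin m) (Fin m) _) *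
        (1 + single ⟨m - (k + 1), by omega⟩ ⟨m - k, by omega⟩ (-Y)) = 1 := by
      rw [mul_add, mul_one, add_mul, one_mul, single_mul_single_of_ne _ _ _ _ (by simp; omega),
        add_zero, add_assoc, ← single_add, add_neg_cancel, single_zero, add_zero]
    rw [← comp_elemBlock, ← comp_elemBlock, ← map_mul, elemBlock_natCast_eq_submatrix hk h₁ h₂,
      elemBlock_neg_natCast_eq_submatrix hk h₁ h₂, submatrix_mul_equiv, h, submatrix_id_id,
      map_one]
  obtain ⟨k, rfl | rfl⟩ := i.eq_nat_or_neg
  · exact key k (by omega) (by omega) X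
  · rw [neg_neg, mul_eq_one_comm]
    simpa only [neg_neg] using key k (by omega) (by omega) (-X)

theorem det_compRingEquiv_diagonal {R : Type*} [CommRing R]
    (d : Fin m → Matrix (Fin n) (Fin n) R) :
    (compRingEquiv (Fin m) (Fin n) R (diagonal d)).det = ∏ p, (d p).det := by
  rw [← det_blockDiagonal, ← det_submatrix_equiv_self (Equiv.prodComm _ _) (blockDiagonal d)]
  congr 1
  ext ⟨p, c⟩ ⟨q, e⟩
  simp only [compRingEquiv_apply, comp_apply, diagonal_apply, submatrix_apply, blockDiagonal_apply,
    Equiv.prodComm_apply, Prod.swap]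
  split_ifs <;> rfl

theorem elemM_zero (X : Matrix (Fin n) (Fin n) ℂ) : elemM m 0 X =
    compRingEquiv (Fin m) (Fin n) ℂ (diagonal fun p => if (p.rev : ℕ) = 0 then X else 1) := by
  rw [← comp_elemBlock]
  congr 1
  ext1 p q
  have h : (p : ℕ) + 1 = m ↔ (p.rev : ℕ) = 0 := by rw [Fin.val_rev]; omega
  simp only [of_apply, elemBlock, diagonal_apply, if_true, h]

theorem elemM_neg_card (X : Matrix (Fin n) (Fin n) ℂ) : elemM m (-m) X =
    compRingEquiv (Fin m) (Fin n) ℂ (diagonal fun p => if (p.rev : ℕ) + 1 = m then X else 1) := by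
  rw [← comp_elemBlock]
  congr 1
  ext1 p q
  have h : (p : ℕ) = 0 ↔ (p.rev : ℕ) + 1 = m := by rw [Fin.val_rev]; omega
  have hm : ¬ -(m : ℤ) = 0 := by have := p.pos; omega
  simp only [of_apply, elemBlock, diagonal_apply, if_true, if_neg hm, h]

theorem det_elemM_ne_zero (i : ℤ) (X : Matrix (Fin n) (Fin n) ℂ)
    (h : (i = 0 ∨ i = -(m : ℤ)) → X.det ≠ 0) : (elemM m i X).det ≠ 0 := by
  obtain rfl | h0 := eq_or_ne i 0
  · rw [elemM_zero, det_compRingEquiv_diagonal, Finset.prod_ne_zero_iff]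
    intro p _
    split_ifs
    exacts [h (.inl rfl), by rw [det_one]; exact one_ne_zero]
  obtain rfl | hm := eq_or_ne i (-m)
  · rw [elemM_neg_card, det_compRingEquiv_diagonal, Finset.prod_ne_zero_iff]
    intro p _
    split_ifs
    exacts [h (.inr rfl), by rw [det_one]; exact one_ne_zero]
  by_cases hi : i.natAbs < m
  · exact det_ne_zero_of_right_inverse (elemM_mul_elemM_neg h0 hi X)
  · have : elemM m i X = 1 := by
      rw [← comp_elemBlock, ← map_one (compRingEquiv (Fin m) (Fin n) ℂ)]
      congr 1
      ext1 p q
      simp only [of_apply, elemBlock, h0, hm, hi, if_false, one_apply]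
    rw [this, det_one]
    exact one_ne_zero

end Elementary

/-- The tuple `(k, k - 2, …)` of positive integers. -/
def altTuple : ℕ → List ℤ
  | 0 => []
  | 1 => [1]
  | (k + 2) => ((k : ℤ) + 2) :: altTuple k

theorem mem_altTuple {k : ℕ} {i : ℤ} :
    i ∈ altTuple k ↔ 1 ≤ i ∧ i ≤ k ∧ i % 2 = (k : ℤ) % 2 := by
  induction k using Nat.twoStepInduction with
  | zero => simp only [altTuple, List.not_mem_nil, false_iff]; omega
  | one => simp only [altTuple, List.mem_singleton]; omega
  | more k ih _ => simp only [altTuple, List.mem_cons, ih]; omega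

theorem pairwise_altTuple (k : ℕ) : (altTuple k).Pairwise fun i j => j + 2 ≤ i := by
  induction k using Nat.twoStepInduction with
  | zero => exact List.Pairwise.nil
  | one => exact List.pairwise_singleton _ _
  | more k ih _ =>
    refine List.pairwise_cons.2 ⟨fun j hj => ?_, ih⟩
    have := (mem_altTuple.1 hj).2.1
    omega

theorem nodup_altTuple (k : ℕ) : (altTuple k).Nodup :=
  (pairwise_altTuple k).imp fun h => by omega

theorem altTuple_succ (k : ℕ) : altTuple (k + 1) = ((k : ℤ) + 1) :: altTuple (k - 1) := by
  rcases k with _ | k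
  · rfl
  · rw [altTuple, Nat.add_sub_cancel]
    push_cast
    ring_nf

theorem str_eq_map (k l : ℤ) :
    str k l = (List.range (l - k + 1).toNat).map fun s : ℕ => k + (s : ℤ) := by
  simp [str, ← List.map_eq_flatMap, Function.comp_def]

theorem str_of_lt {k l : ℤ} (h : l < k) : str k l = [] := by
  rw [str_eq_map, Int.toNat_of_nonpos (by omega), List.range_zero, List.map_nil]

theorem str_cons {k l : ℤ} (h : k ≤ l) : str k l = k :: str (k + 1) l := by
  obtain ⟨d, rfl⟩ := Int.le.dest h
  have h₁ : (k + d - k + 1).toNat = d + 1 := by omega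
  have h₂ : (k + d - (k + 1) + 1).toNat = d := by omega
  rw [str_eq_map, str_eq_map, h₁, h₂, List.range_succ_eq_map, List.map_cons, List.map_map]
  refine congrArg₂ _ (by simp) (List.map_congr_left fun s _ => ?_)
  simp only [Function.comp_apply, Nat.succ_eq_add_one, Nat.cast_add, Nat.cast_one]
  ring

theorem str_concat {k l : ℤ} (h : k ≤ l + 1) : str k (l + 1) = str k l ++ [l + 1] := by
  obtain ⟨d, hd⟩ := Int.le.dest h
  have h₁ : (l + 1 - k + 1).toNat = d + 1 := by omega
  have h₂ : (l - k + 1).toNat = d := by omega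
  rw [str_eq_map, str_eq_map, h₁, h₂, List.range_succ, List.map_append, List.map_singleton, hd]

theorem mem_str {k l i : ℤ} : i ∈ str k l ↔ k ≤ i ∧ i ≤ l := by
  simp only [str_eq_map, List.mem_map, List.mem_range]
  exact ⟨by rintro ⟨s, hs, rfl⟩; omega, fun h => ⟨(i - k).toNat, by omega, by omega⟩⟩

theorem str_self (k : ℤ) : str k k = [k] := by
  rw [str_cons le_rfl, str_of_lt (by omega)]

theorem simpleTuple_zero : simpleTuple 0 = [0] := str_self 0

theorem simpleTuple_one : simpleTuple 1 = [0, 1] := by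
  change str 0 (0 + 1) = [0, 1]
  rw [str_concat (by omega), str_self]
  rfl

theorem admissibleTuple_eq (h p : ℕ) : admissibleTuple h p =
    ((List.range ((h - p) / 2)).flatMap fun k : ℕ =>
      str ((h : ℤ) - 2 * (k : ℤ) - 1) ((h : ℤ) - 2 * (k : ℤ))) ++ str 0 p := by
  simp [admissibleTuple, List.flatMap_assoc]

theorem symmComplement_eq (h p : ℕ) : symmComplement h p =
    ((List.range ((h - p) / 2)).map fun k : ℕ => (h : ℤ) - 2 * (k : ℤ) - 1) ++
      (List.range p).flatMap fun k : ℕ => str 0 ((p : ℤ) - 1 - (k : ℤ)) := by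
  simp [symmComplement, ← List.map_eq_flatMap, List.flatMap_map, Function.comp_def]

theorem simpleTuple_add_two (k : ℕ) :
    simpleTuple (k + 2) = ((k : ℤ) + 1) :: ((k : ℤ) + 2) :: simpleTuple k := by
  have h₁ : (k + 2) % 2 = k % 2 := by omega
  have h₂ : (k + 2 - k % 2) / 2 = (k - k % 2) / 2 + 1 := by omega
  have h₃ : str ((k + 2 : ℕ) - 2 * (0 : ℕ) - 1) ((k + 2 : ℕ) - 2 * (0 : ℕ)) =
      [(k : ℤ) + 1, (k : ℤ) + 2] := by
    rw [str_cons (by omega), ← str_self]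
    push_cast
    ring_nf
  have h₄ (j : ℕ) : str ((k + 2 : ℕ) - 2 * (j + 1 : ℕ) - 1) ((k + 2 : ℕ) - 2 * (j + 1 : ℕ)) =
      str (k - 2 * j - 1) (k - 2 * j) := by
    push_cast
    ring_nf
  rw [simpleTuple, simpleTuple, admissibleTuple_eq, admissibleTuple_eq, h₁, h₂,
    List.range_succ_eq_map, List.flatMap_cons, List.flatMap_map, h₃]
  simp only [Nat.succ_eq_add_one, h₄, List.cons_append, List.nil_append]

theorem simpleComplement_add_two (k : ℕ) :
    simpleComplement (k + 2) = ((k : ℤ) + 1) :: simpleComplement k := by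
  have h₁ : (k + 2) % 2 = k % 2 := by omega
  have h₂ : (k + 2 - k % 2) / 2 = (k - k % 2) / 2 + 1 := by omega
  have h₃ : ((k + 2 : ℕ) : ℤ) - 2 * (0 : ℕ) - 1 = k + 1 := by push_cast; ring
  have h₄ (j : ℕ) : ((k + 2 : ℕ) : ℤ) - 2 * (j + 1 : ℕ) - 1 = k - 2 * j - 1 := by push_cast; ring
  rw [simpleComplement, simpleComplement, symmComplement_eq, symmComplement_eq, h₁, h₂,
    List.range_succ_eq_map, List.map_cons, List.map_map, List.cons_append, h₃]
  simp only [Function.comp_def, Nat.succ_eq_add_one, h₄]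

theorem simpleComplement_eq (k : ℕ) :
    simpleComplement k = altTuple (k - 1) ++ (if k % 2 = 1 then [0] else []) := by
  induction k using Nat.twoStepInduction with
  | zero => rfl
  | one => rfl
  | more k ih _ =>
    rw [simpleComplement_add_two, ih, show k + 2 - 1 = k + 1 from rfl, altTuple_succ,
      List.cons_append, Nat.add_mod_right]

theorem simpleComplement_of_even {h : ℕ} (hh : Even h) :
    simpleComplement h = altTuple (h - 1) := by
  rw [simpleComplement_eq, Nat.even_iff.1 hh, if_neg zero_ne_one, List.append_nil]

theorem exists_simpleTuple_eq_append (k : ℕ) :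
    ∃ s t : List ℤ, simpleTuple k = s ++ 0 :: t ∧ ∀ i ∈ s ++ t, 1 ≤ i ∧ i ≤ k := by
  induction k using Nat.twoStepInduction with
  | zero => exact ⟨[], [], simpleTuple_zero, by simp⟩
  | one => exact ⟨[], [1], simpleTuple_one, by simp⟩
  | more k ih _ =>
    obtain ⟨s, t, hk, hst⟩ := ih
    refine ⟨(k + 1) :: (k + 2) :: s, t, by rw [simpleTuple_add_two, hk]; rfl, fun i hi => ?_⟩
    rw [List.cons_append, List.cons_append, List.mem_cons, List.mem_cons] at hi
    rcases hi with hi | hi | hi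
    · omega
    · omega
    · have := hst i hi
      omega

section Products
variable {A : Type*} [Monoid A] (N : ℤ → A)

theorem commute_prod_map {N : ℤ → A} {i : ℤ} {t : List ℤ} (h : ∀ j ∈ t, Commute (N i) (N j)) :
    Commute (N i) (t.map N).prod :=
  Commute.list_prod_right _ _ (List.forall_mem_map.2 h)

theorem prod_map_simpleTuple (k : ℕ)
    (hN : ∀ i j : ℤ, 0 ≤ i → i + 2 ≤ j → j ≤ k → Commute (N i) (N j)) :
    ((simpleTuple k).map N).prod =
      ((altTuple (k - 1)).map N).prod * N 0 * ((altTuple k).map N).prod := by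
  induction k using Nat.twoStepInduction with
  | zero => simp [simpleTuple_zero, altTuple]
  | one => simp [simpleTuple_one, altTuple]
  | more k ih _ =>
    have hc : Commute (N (k + 2)) (((altTuple (k - 1)).map N).prod * N 0) := by
      refine Commute.mul_right (commute_prod_map fun j hj => ?_)
        (hN 0 _ le_rfl (by omega) (by push_cast; rfl)).symm
      have := mem_altTuple.1 hj
      exact (hN j _ (by omega) (by omega) (by push_cast; rfl)).symm
    rw [simpleTuple_add_two, show k + 2 - 1 = k + 1 from rfl, altTuple_succ, altTuple,
      List.map_cons, List.map_cons, List.map_cons, List.map_cons, List.prod_cons, List.prod_cons,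
      List.prod_cons, List.prod_cons,
      ih fun i j h₁ h₂ h₃ => hN i j h₁ h₂ (by push_cast; omega), ← mul_assoc (N (k + 2)), hc.eq]
    simp only [mul_assoc]

theorem prod_map_simpleTuple_two_mul (q : ℕ)
    (hN : ∀ i j : ℤ, 1 ≤ i → i + 2 ≤ j → j ≤ 2 * q → Commute (N i) (N j)) :
    ((simpleTuple (2 * q)).map N).prod =
      ((altTuple (2 * q - 1)).map N).prod * ((altTuple (2 * q)).map N).prod * N 0 := by
  induction q with
  | zero => simp [simpleTuple_zero, altTuple]
  | succ q ih =>
    have hc : Commute (N ((2 * q : ℕ) + 2)) ((altTuple (2 * q - 1)).map N).prod := by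
      refine commute_prod_map fun j hj => ?_
      have := mem_altTuple.1 hj
      exact (hN j _ (by omega) (by omega) (by push_cast; omega)).symm
    rw [show 2 * (q + 1) = 2 * q + 2 from rfl, simpleTuple_add_two,
      show 2 * q + 2 - 1 = 2 * q + 1 from rfl, altTuple_succ, altTuple,
      List.map_cons, List.map_cons, List.map_cons, List.map_cons, List.prod_cons, List.prod_cons,
      List.prod_cons, List.prod_cons,
      ih fun i j h₁ h₂ h₃ => hN i j h₁ h₂ (by push_cast; omega), mul_assoc (List.prod _),
      ← mul_assoc (N ((2 * q : ℕ) + 2)), hc.eq]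
    simp only [mul_assoc]

end Products

section FiedlerProducts
variable {n : ℕ} (m : ℕ) (a : ℕ → Matrix (Fin n) (Fin n) ℂ)

theorem prodP_append (s t : List ℤ) : prodP m a (s ++ t) = prodP m a s * prodP m a t := by
  rw [prodP, List.map_append, List.prod_append, prodP, prodP]

theorem prodP_singleton (i : ℤ) : prodP m a [i] = fiedlerP m a i :=
  List.prod_singleton

theorem fiedlerP_commute {i j : ℤ} (h : Far i j) :
    Commute (fiedlerP m a i) (fiedlerP m a j) :=
  elemM_commute _ _ h

theorem prodP_commute {s t : List ℤ} (h : ∀ i ∈ s, ∀ j ∈ t, Far i j) :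
    Commute (prodP m a s) (prodP m a t) :=
  Commute.list_prod_right _ _ <| List.forall_mem_map.2 fun j hj =>
    (commute_prod_map fun i hi => (fiedlerP_commute m a (h i hi j hj)).symm).symm

theorem fiedlerP_mul_fiedlerP_neg {i : ℤ} (h0 : i ≠ 0) (hi : i.natAbs < m) :
    fiedlerP m a i * fiedlerP m a (-i) = 1 := by
  rw [← elemM_mul_elemM_neg h0 hi (if 0 ≤ i then -a i.natAbs else a i.natAbs), fiedlerP, fiedlerP,
    Int.natAbs_neg]
  congr 2
  rcases h0.lt_or_gt with h | h
  · rw [if_pos (by omega), if_neg (by omega)]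
  · rw [if_neg (by omega), if_pos h.le, neg_neg]

/-- The tuple of the indices of the factors of the inverse of `M_t^P`. -/
def invTuple (t : List ℤ) : List ℤ := (t.map Neg.neg).reverse

theorem mem_invTuple {t : List ℤ} {i : ℤ} : i ∈ invTuple t ↔ -i ∈ t := by
  rw [invTuple, List.mem_reverse, List.mem_map_of_involutive neg_involutive]

theorem mem_shift {k i : ℤ} {t : List ℤ} : i ∈ shift k t ↔ i - k ∈ t := by
  simp only [shift, List.mem_map, ← eq_sub_iff_add_eq, exists_eq_right]

theorem prodP_mul_invTuple {t : List ℤ} (ht : ∀ i ∈ t, i ≠ 0 ∧ i.natAbs < m) :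
    prodP m a t * prodP m a (invTuple t) = 1 := by
  induction t with
  | nil => exact mul_one 1
  | cons i t ih =>
    rw [List.forall_mem_cons] at ht
    rw [invTuple, List.map_cons, List.reverse_cons, prodP_append, prodP_singleton, ← invTuple,
      ← List.singleton_append, prodP_append, prodP_singleton, mul_assoc,
      ← mul_assoc (prodP m a t), ih ht.2, one_mul, fiedlerP_mul_fiedlerP_neg m a ht.1.1 ht.1.2]

theorem det_prodP_ne_zero {t : List ℤ} (ht : ∀ i ∈ t, i ≠ 0 ∧ (i = -m → (a m).det ≠ 0)) :
    (prodP m a t).det ≠ 0 := by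
  rw [prodP, ← coe_detMonoidHom, map_list_prod, List.map_map]
  refine List.prod_ne_zero fun h => ?_
  obtain ⟨i, hi, h0⟩ := List.mem_map.1 h
  refine det_elemM_ne_zero i _ (fun him => ?_) h0
  obtain ⟨hi0, hm⟩ := ht i hi
  obtain rfl := him.resolve_left hi0
  rw [if_neg (by omega), Int.natAbs_neg, Int.natAbs_natCast]
  exact hm rfl

variable (h : ℕ)

/-- The product of the Fiedler matrices common to `M_v^P` and `M_w^P`. -/
noncomputable def outerFactor : Matrix (Fin m × Fin n) (Fin m × Fin n) ℂ :=
  prodP m a (altTuple (h - 1)) * prodP m a (shift (-m) (altTuple (m - h - 1 - 1)))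

/-- The indices of the factors of `M_v^P` other than `-m` once the outer factor is split off. -/
def oddTuple : List ℤ := shift (-m) (altTuple (m - h - 1)) ++ invTuple (altTuple (h - 1))

/-- The indices of the factors of `M_w^P` once the outer factor is split off. -/
def evenTuple : List ℤ :=
  altTuple h ++ invTuple (shift (-m) (altTuple (m - h - 1 - 1))) ++ [0]

variable {m h}

variable (hh : Even h) (hm : h < m)
include hh hm

theorem mem_oddTuple {i : ℤ} : i ∈ oddTuple m h ↔ -(m : ℤ) < i ∧ i < 0 ∧ i % 2 = 1 := by
  obtain ⟨q, hq⟩ := hh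
  simp only [oddTuple, List.mem_append, mem_shift, mem_invTuple, mem_altTuple]
  omega

theorem mem_evenTuple {i : ℤ} : i ∈ evenTuple m h ↔ 0 ≤ i ∧ i < m ∧ i % 2 = 0 := by
  obtain ⟨q, hq⟩ := hh
  simp only [evenTuple, List.mem_append, mem_shift, mem_invTuple, mem_altTuple,
    List.mem_singleton]
  omega

theorem pairwise_far_oddTuple : (oddTuple m h).Pairwise Far := by
  have hnd : (oddTuple m h).Nodup := by
    refine List.nodup_append'.2 ⟨(nodup_altTuple _).map (add_left_injective _),
      List.nodup_reverse.2 ((nodup_altTuple _).map neg_injective), fun i hi hj => ?_⟩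
    rw [mem_shift, mem_altTuple] at hi
    rw [mem_invTuple, mem_altTuple] at hj
    omega
  refine hnd.pairwise_of_forall_ne fun i hi j hj hij => ?_
  rw [mem_oddTuple hh hm] at hi hj
  unfold Far
  omega

theorem pairwise_far_evenTuple : (evenTuple m h).Pairwise Far := by
  have hnd : (evenTuple m h).Nodup := by
    refine List.nodup_append'.2 ⟨List.nodup_append'.2 ⟨nodup_altTuple _, List.nodup_reverse.2
      (((nodup_altTuple _).map (add_left_injective _)).map neg_injective), fun i hi hj => ?_⟩,
      List.nodup_singleton 0, fun i hi hj => ?_⟩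
    · rw [mem_invTuple, mem_shift, mem_altTuple] at hj
      rw [mem_altTuple] at hi
      omega
    · rw [List.mem_append, mem_altTuple, mem_invTuple, mem_shift, mem_altTuple] at hi
      rw [List.mem_singleton] at hj
      omega
  refine hnd.pairwise_of_forall_ne fun i hi j hj hij => ?_
  rw [mem_evenTuple hh hm] at hi hj
  unfold Far
  omega

theorem prodP_shift_simpleTuple : prodP m a (shift (-m) (simpleTuple (m - h - 1))) =
    outerFactor m a h * (fiedlerP m a (-m) * prodP m a (oddTuple m h)) := by
  have hinv : prodP m a (altTuple (h - 1)) * prodP m a (invTuple (altTuple (h - 1))) = 1 :=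
    prodP_mul_invTuple m a fun i hi => by rw [mem_altTuple] at hi; omega
  have hprod : prodP m a (shift (-m) (simpleTuple (m - h - 1))) =
      prodP m a (shift (-m) (altTuple (m - h - 1 - 1)) ++ [-(m : ℤ)] ++
        shift (-m) (altTuple (m - h - 1))) := by
    rw [prodP_append, prodP_append, prodP_singleton]
    simp only [prodP, shift, List.map_map]
    rw [prod_map_simpleTuple (fiedlerP m a ∘ (· + -(m : ℤ))), Function.comp_apply, zero_add]
    exact fun i j _ h₂ h₃ => fiedlerP_commute m a (by unfold Far; dsimp only; omega)
  have hcomm : Commute (prodP m a (altTuple (h - 1)))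
      (prodP m a (shift (-m) (simpleTuple (m - h - 1)))) := by
    rw [hprod]
    refine prodP_commute m a fun i hi j hj => ?_
    obtain ⟨q, hq⟩ := hh
    simp only [List.mem_append, mem_shift, mem_altTuple, List.mem_singleton] at hi hj
    unfold Far
    omega
  rw [← mul_one (prodP m a (shift _ _)), ← hinv, ← mul_assoc, ← hcomm.eq, hprod, outerFactor,
    oddTuple, prodP_append, prodP_append, prodP_append, prodP_singleton]
  simp only [mul_assoc]

theorem prodP_simpleTuple : prodP m a (simpleTuple h) =
    outerFactor m a h * prodP m a (evenTuple m h) := by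
  have hinv : prodP m a (shift (-m) (altTuple (m - h - 1 - 1))) *
      prodP m a (invTuple (shift (-m) (altTuple (m - h - 1 - 1)))) = 1 :=
    prodP_mul_invTuple m a fun i hi => by rw [mem_shift, mem_altTuple] at hi; omega
  have hprod : prodP m a (simpleTuple h) =
      prodP m a (altTuple (h - 1)) * prodP m a (altTuple h) * fiedlerP m a 0 := by
    obtain ⟨q, rfl⟩ := even_iff_exists_two_mul.1 hh
    exact prod_map_simpleTuple_two_mul _ _ fun i j h₁ h₂ _ =>
      fiedlerP_commute m a (by unfold Far; omega)
  have hcomm : Commute (prodP m a (shift (-m) (altTuple (m - h - 1 - 1))))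
      (prodP m a (altTuple h)) := by
    refine prodP_commute m a fun i hi j hj => ?_
    simp only [mem_shift, mem_altTuple] at hi hj
    unfold Far
    omega
  rw [hprod, ← mul_one (prodP m a (altTuple h)), ← hinv, ← mul_assoc (prodP m a (altTuple h)),
    ← hcomm.eq, outerFactor, evenTuple, prodP_append, prodP_append, prodP_singleton]
  simp only [mul_assoc]

end FiedlerProducts

section Tridiagonal

/-- The matrix whose `(p, q)` entry is `θ k l`, where `k` and `l` are the levels of `p` and `q`. -/
def ofLevels {M : Type*} (m : ℕ) (θ : ℕ → ℕ → M) : Matrix (Fin m) (Fin m) M :=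
  of fun p q => θ p.rev q.rev

/-- The entries, indexed by levels, of the symmetric tridiagonal pencil `s 𝒪 - t ℰ`, where `𝒪` is
the product of `M_{-m}^P` and of the odd Fiedler matrices `M_{-i}^P`, and `ℰ` is the product of the
even Fiedler matrices `M_i^P`. -/
def theta {R M : Type*} [CommRing R] [Ring M] [Algebra R M] (m : ℕ) (s t : R) (a : ℕ → M)
    (k l : ℕ) : M :=
  if k = l then
    if k % 2 = 0 then s • a (k + 1) + t • a k else if k + 1 = m then (-t) • 1 else 0
  else if k = l + 1 then
    if k % 2 = 0 then (-t) • 1 else if k + 1 = m then s • a (k + 1) else s • 1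
  else if l = k + 1 then
    if l % 2 = 0 then (-t) • 1 else s • 1
  else 0

variable {n m h : ℕ} (a : ℕ → Matrix (Fin n) (Fin n) ℂ) (hh : Even h) (hm : h < m)

theorem isLocal_coeff (i : ℤ) : IsLocal (levelSupport m i)
    (of (elemBlock m i (if 0 ≤ i then -a i.natAbs else a i.natAbs))) :=
  isLocal_elemBlock i _

theorem elemBlock_level (X : Matrix (Fin n) (Fin n) ℂ) (p q : Fin m) :
    elemBlock m p.rev X p q =
      if (p.rev : ℕ) = q.rev then X else if (p.rev : ℕ) = q.rev + 1 then 1 else 0 := by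
  simp only [elemBlock, Fin.val_rev, ← Fin.val_inj]
  split_ifs <;> first | rfl | omega

theorem elemBlock_level_add_one (X : Matrix (Fin n) (Fin n) ℂ) (p q : Fin m)
    (h : (p.rev : ℕ) + 1 < m) :
    elemBlock m (p.rev + 1) X p q = if (q.rev : ℕ) = p.rev + 1 then 1 else 0 := by
  simp only [elemBlock, Fin.val_rev, ← Fin.val_inj] at h ⊢
  split_ifs <;> first | rfl | omega

theorem elemBlock_neg_level (X : Matrix (Fin n) (Fin n) ℂ) (p q : Fin m) (h : (p.rev : ℕ) ≠ 0) :
    elemBlock m (-p.rev) X p q = if (p.rev : ℕ) = q.rev + 1 then 1 else 0 := by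
  simp only [elemBlock, Fin.val_rev, ← Fin.val_inj] at h ⊢
  split_ifs <;> first | rfl | omega

theorem elemBlock_neg_level_sub_one (X : Matrix (Fin n) (Fin n) ℂ) (p q : Fin m)
    (h : (p.rev : ℕ) + 1 < m) : elemBlock m (-(p.rev + 1)) X p q =
      if (p.rev : ℕ) = q.rev then X else if (q.rev : ℕ) = p.rev + 1 then 1 else 0 := by
  simp only [elemBlock, Fin.val_rev, ← Fin.val_inj] at h ⊢
  split_ifs <;> first | rfl | omega

theorem prodP_eq_comp (t : List ℤ) : prodP m a t = compRingEquiv (Fin m) (Fin n) ℂ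
    (t.map fun i => of (elemBlock m i (if 0 ≤ i then -a i.natAbs else a i.natAbs))).prod := by
  rw [map_list_prod, List.map_map]
  rfl

include hh hm

theorem prodP_evenTuple : prodP m a (evenTuple m h) = compRingEquiv (Fin m) (Fin n) ℂ
    (ofLevels m (theta m (0 : ℂ) (-1) a)) := by
  have ht := (pairwise_far_evenTuple hh hm).imp fun {i j} => Far.disjoint (m := m)
  have hloc (i : ℤ) (_ : i ∈ evenTuple m h) := isLocal_coeff (m := m) a i
  rw [prodP_eq_comp]
  congr 1
  ext1 p q
  have := p.rev.2
  have hpq : p = q ↔ (p.rev : ℕ) = q.rev := by rw [Fin.val_inj, Fin.rev_inj]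
  change _ = theta m (0 : ℂ) (-1) a p.rev q.rev
  by_cases hp : (p.rev : ℕ) % 2 = 0
  · rw [prod_apply_of_mem (i := (p.rev : ℤ)) hloc ht (by rw [mem_evenTuple hh hm]; omega)
      (.inl rfl), of_apply, elemBlock_level, if_pos (Int.natCast_nonneg _), Int.natAbs_natCast]
    unfold theta
    split_ifs <;> first | omega | simp
  by_cases hpm : (p.rev : ℕ) + 1 = m
  · rw [isLocal_prod hloc ht p q (.inl fun ⟨i, hi, hpi⟩ => ?_), one_apply,
      if_congr hpq rfl rfl]
    · unfold theta
      split_ifs <;> first | omega | simp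
    · simp only [levelSupport, Set.mem_ofPred_eq, mem_evenTuple hh hm] at hi hpi
      omega
  · rw [prod_apply_of_mem (i := (p.rev : ℤ) + 1) hloc ht (by rw [mem_evenTuple hh hm]; omega)
      (.inr (by omega)), of_apply, elemBlock_level_add_one _ _ _ (by omega)]
    unfold theta
    split_ifs <;> first | omega | simp

theorem fiedlerP_mul_prodP_oddTuple : fiedlerP m a (-m) * prodP m a (oddTuple m h) =
    compRingEquiv (Fin m) (Fin n) ℂ (ofLevels m (theta m (1 : ℂ) 0 a)) := by
  have ht := (pairwise_far_oddTuple hh hm).imp fun {i j} => Far.disjoint (m := m)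
  have hloc (i : ℤ) (_ : i ∈ oddTuple m h) := isLocal_coeff (m := m) a i
  rw [prodP_eq_comp, fiedlerP, elemM_neg_card, ← map_mul, if_neg (by omega), Int.natAbs_neg,
    Int.natAbs_natCast]
  congr 1
  ext1 p q
  have := p.rev.2
  have hpq : p = q ↔ (p.rev : ℕ) = q.rev := by rw [Fin.val_inj, Fin.rev_inj]
  have hd : (if (p.rev : ℕ) + 1 = m then a m else 1) =
      if (p.rev : ℕ) + 1 = m then a (p.rev + 1) else 1 := by
    split_ifs with h
    exacts [by rw [h], rfl]
  rw [diagonal_mul, hd]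
  change _ = theta m (1 : ℂ) 0 a p.rev q.rev
  by_cases hp : (p.rev : ℕ) % 2 = 1
  · rw [prod_apply_of_mem (i := -(p.rev : ℤ)) hloc ht (by rw [mem_oddTuple hh hm]; omega)
      (.inl (by omega)), of_apply, elemBlock_neg_level _ _ _ (by omega)]
    unfold theta
    split_ifs <;> first | omega | simp only [*, one_smul, zero_smul, neg_zero, mul_one, mul_zero]
  by_cases hpm : (p.rev : ℕ) + 1 = m
  · rw [isLocal_prod hloc ht p q (.inl fun ⟨i, hi, hpi⟩ => ?_), one_apply,
      if_congr hpq rfl rfl]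
    · unfold theta
      split_ifs <;> first
      | omega
      | simp only [*, one_smul, zero_smul, neg_zero, mul_one, mul_zero, add_zero]
    · simp only [levelSupport, Set.mem_ofPred_eq, mem_oddTuple hh hm] at hi hpi
      omega
  · rw [prod_apply_of_mem (i := -((p.rev : ℤ) + 1)) hloc ht (by rw [mem_oddTuple hh hm]; omega)
      (.inr (by omega)), of_apply, elemBlock_neg_level_sub_one _ _ _ (by omega),
      if_neg (by omega : ¬ 0 ≤ -((p.rev : ℤ) + 1)), if_neg hpm,
      show (-((p.rev : ℤ) + 1)).natAbs = (p.rev : ℕ) + 1 by omega]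
    unfold theta
    split_ifs <;> first | omega | simp

end Tridiagonal

section Columns
variable {R M : Type*} [CommRing R] [Ring M] [Algebra R M] (m : ℕ) (s t : R) (a c : ℕ → M)

theorem sum_theta_two_mul {j : ℕ} (hj : 2 * j < m) :
    ∑ l ∈ Finset.range m, theta m s t a (2 * j) l * c l =
      (s • a (2 * j + 1) + t • a (2 * j)) * c (2 * j)
        - (if j = 0 then 0 else t • c (2 * j - 1))
        + if 2 * j + 1 < m then s • c (2 * j + 1) else 0 := by
  have hθ (l : ℕ) : theta m s t a (2 * j) l * c l =
      (if l = 2 * j then (s • a (2 * j + 1) + t • a (2 * j)) * c l else 0)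
        + (if l = 2 * j - 1 then if j = 0 then 0 else -(t • c l) else 0)
        + if l = 2 * j + 1 then s • c l else 0 := by
    unfold theta
    split_ifs <;> first | omega | simp
  simp only [hθ, Finset.sum_add_distrib, Finset.sum_ite_eq', Finset.mem_range, if_pos hj]
  split_ifs <;> first | omega | simp [sub_eq_add_neg]

theorem sum_theta_two_mul_add_one {j : ℕ} (hj : 2 * j + 2 < m) :
    ∑ l ∈ Finset.range m, theta m s t a (2 * j + 1) l * c l =
      s • c (2 * j) - t • c (2 * j + 2) := by
  have hθ (l : ℕ) : theta m s t a (2 * j + 1) l * c l =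
      (if l = 2 * j then s • c l else 0) + if l = 2 * j + 2 then -(t • c l) else 0 := by
    unfold theta
    split_ifs <;> first | omega | simp
  simp only [hθ, Finset.sum_add_distrib, Finset.sum_ite_eq', Finset.mem_range, if_pos hj,
    if_pos (show 2 * j < m by omega), sub_eq_add_neg]

theorem sum_theta_last {j : ℕ} (hj : 2 * j + 2 = m) :
    ∑ l ∈ Finset.range m, theta m s t a (2 * j + 1) l * c l =
      s • (a m * c (2 * j)) - t • c (2 * j + 1) := by
  subst hj
  have hθ (l : ℕ) (hl : l ∈ Finset.range (2 * j + 2)) :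
      theta (2 * j + 2) s t a (2 * j + 1) l * c l =
      (if l = 2 * j then s • (a (2 * j + 2) * c l) else 0)
        + if l = 2 * j + 1 then -(t • c l) else 0 := by
    rw [Finset.mem_range] at hl
    unfold theta
    split_ifs <;> first | omega | simp
  simp only [Finset.sum_congr rfl hθ, Finset.sum_add_distrib, Finset.sum_ite_eq', Finset.mem_range,
    if_pos (show 2 * j < 2 * j + 2 by omega), if_pos (show 2 * j + 1 < 2 * j + 2 by omega),
    sub_eq_add_neg]

/-- The Horner shift `a_d + s a_{d+1} + ⋯ + s^{m-d} a_m`. -/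
def hornerUp (d : ℕ) : M := ∑ i ∈ Finset.range (m + 1 - d), s ^ i • a (d + i)

theorem hornerUp_of_le {d : ℕ} (hd : d ≤ m) :
    hornerUp m s a d = a d + s • hornerUp m s a (d + 1) := by
  rw [hornerUp, show m + 1 - d = m + 1 - (d + 1) + 1 by omega, Finset.sum_range_succ',
    pow_zero, one_smul, add_zero, add_comm, hornerUp, Finset.smul_sum]
  simp only [smul_smul, pow_succ', add_right_comm, add_assoc]

theorem hornerUp_of_lt {d : ℕ} (hd : m < d) : hornerUp m s a d = 0 := by
  rw [hornerUp, Nat.sub_eq_zero_of_le hd, Finset.sum_range_zero]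

/-- The entries, indexed by levels, of the block column that `s 𝒪 - ℰ` maps to a multiple of the
block column supported at level `0`. -/
def colUp (k : ℕ) : M :=
  if k % 2 = 0 then s ^ (k / 2) • 1 else s ^ (k / 2 + 1) • hornerUp m s a (k + 1)

theorem colUp_two_mul (j : ℕ) : colUp m s a (2 * j) = s ^ j • 1 := by
  rw [colUp, if_pos (by omega), Nat.mul_div_cancel_left _ two_pos]

theorem colUp_two_mul_add_one (j : ℕ) :
    colUp m s a (2 * j + 1) = s ^ (j + 1) • hornerUp m s a (2 * j + 2) := by
  rw [colUp, if_neg (by omega), show (2 * j + 1) / 2 = j by omega]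

theorem sum_theta_mul_colUp {k : ℕ} (hk : k < m) :
    ∑ l ∈ Finset.range m, theta m s 1 a k l * colUp m s a l =
      if k = 0 then hornerUp m s a 0 else 0 := by
  obtain ⟨j, rfl | rfl⟩ := k.even_or_odd'
  · have hH : hornerUp m s a (2 * j) = a (2 * j) + s • a (2 * j + 1) +
        s ^ 2 • hornerUp m s a (2 * j + 2) := by
      rw [hornerUp_of_le m s a hk.le, hornerUp_of_le m s a hk, smul_add, smul_smul, sq, add_assoc]
    have hlast : (if 2 * j + 1 < m then s • colUp m s a (2 * j + 1) else 0) =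
        s • colUp m s a (2 * j + 1) := by
      split_ifs with hj
      · rfl
      · rw [colUp_two_mul_add_one, hornerUp_of_lt m s a (by omega), smul_zero, smul_zero]
    rw [sum_theta_two_mul m s 1 a _ hk, hlast, colUp_two_mul, colUp_two_mul_add_one, mul_smul_one]
    rcases j with _ | j
    · rw [if_pos rfl, if_pos rfl, hH]
      module
    · rw [if_neg (by omega), if_neg (by omega), show 2 * (j + 1) - 1 = 2 * j + 1 by omega,
        colUp_two_mul_add_one, show 2 * j + 2 = 2 * (j + 1) by ring, hH]
      module
  · rw [if_neg (by omega)]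
    obtain hj | hj : 2 * j + 2 < m ∨ 2 * j + 2 = m := by omega
    · rw [sum_theta_two_mul_add_one m s 1 a _ hj, show 2 * j + 2 = 2 * (j + 1) by ring,
        colUp_two_mul, colUp_two_mul]
      module
    · rw [sum_theta_last m s 1 a _ hj, colUp_two_mul, colUp_two_mul_add_one, hj,
        hornerUp_of_le m s a le_rfl, hornerUp_of_lt m s a m.lt_succ_self, mul_smul_one]
      module

/-- The truncation `a_k + t a_{k-1} + ⋯ + t^k a_0`. -/
def hornerDown (k : ℕ) : M := ∑ i ∈ Finset.range (k + 1), t ^ (k - i) • a i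

theorem hornerDown_zero : hornerDown t a 0 = a 0 := by
  rw [hornerDown, Finset.sum_range_one, Nat.sub_self, pow_zero, one_smul]

theorem hornerDown_update_zero (z : M) (k : ℕ) :
    hornerDown t (Function.update a 0 (a 0 + z)) k = hornerDown t a k + t ^ k • z := by
  rw [hornerDown, hornerDown, Finset.sum_range_succ', Finset.sum_range_succ']
  simp [add_assoc]

theorem hornerDown_succ (k : ℕ) :
    hornerDown t a (k + 1) = a (k + 1) + t • hornerDown t a k := by
  rw [hornerDown, Finset.sum_range_succ, Nat.sub_self, pow_zero, one_smul, add_comm, hornerDown,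
    Finset.smul_sum]
  refine congrArg _ (Finset.sum_congr rfl fun i hi => ?_)
  rw [smul_smul, ← pow_succ', Nat.sub_add_comm (Finset.mem_range_succ_iff.1 hi)]

/-- For `m = 2 q + 1`, the entries, indexed by levels, of the block column that `𝒪 - t ℰ` maps to a
multiple of the block column supported at the highest level `2 q`. -/
def colDown (q k : ℕ) : M :=
  if k % 2 = 0 then t ^ (q - k / 2) • 1 else -(t ^ (q - k / 2) • hornerDown t a k)

theorem colDown_two_mul (q j : ℕ) : colDown t a q (2 * j) = t ^ (q - j) • 1 := by
  rw [colDown, if_pos (by omega), Nat.mul_div_cancel_left _ two_pos]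

theorem colDown_two_mul_add_one (q j : ℕ) :
    colDown t a q (2 * j + 1) = -(t ^ (q - j) • hornerDown t a (2 * j + 1)) := by
  rw [colDown, if_neg (by omega), show (2 * j + 1) / 2 = j by omega]

theorem sum_theta_mul_colDown {q k : ℕ} (hk : k < 2 * q + 1) :
    ∑ l ∈ Finset.range (2 * q + 1), theta (2 * q + 1) 1 t a k l * colDown t a q l =
      if k = 2 * q then hornerDown t a (2 * q + 1) else 0 := by
  obtain ⟨j, rfl | rfl⟩ := k.even_or_odd'
  · have hH : hornerDown t a (2 * j + 1) = a (2 * j + 1) + t • a (2 * j) +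
        if j = 0 then 0 else t ^ 2 • hornerDown t a (2 * j - 1) := by
      rw [hornerDown_succ]
      rcases j with _ | j
      · rw [if_pos rfl, add_zero, mul_zero, hornerDown_zero]
      · rw [if_neg (by omega), show 2 * (j + 1) = 2 * j + 1 + 1 by ring, hornerDown_succ, smul_add,
          smul_smul, sq, ← add_assoc, Nat.add_sub_cancel]
    have hprev : (if j = 0 then 0 else t • colDown t a q (2 * j - 1)) =
        -(t ^ (q - j) • if j = 0 then 0 else t ^ 2 • hornerDown t a (2 * j - 1)) := by
      rcases j with _ | j
      · rw [if_pos rfl, if_pos rfl, smul_zero, neg_zero]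
      · rw [if_neg (by omega), if_neg (by omega), show 2 * (j + 1) - 1 = 2 * j + 1 by omega,
          colDown_two_mul_add_one, show q - j = q - (j + 1) + 1 by omega]
        module
    rw [sum_theta_two_mul _ 1 t a _ hk, hprev, colDown_two_mul, colDown_two_mul_add_one,
      mul_smul_one, one_smul]
    obtain hj | rfl : j < q ∨ j = q := by omega
    · rw [if_pos (show 2 * j + 1 < 2 * q + 1 by omega), if_neg (show 2 * j ≠ 2 * q by omega), hH]
      module
    · rw [if_neg (lt_irrefl _), if_pos rfl, hH, Nat.sub_self]
      module
  · rw [sum_theta_two_mul_add_one _ 1 t a _ (by omega), if_neg (by omega),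
      show 2 * j + 2 = 2 * (j + 1) by ring, colDown_two_mul, colDown_two_mul,
      show q - j = q - (j + 1) + 1 by omega]
    module

end Columns

section TriangularDeterminants
variable {R ι κ : Type*} [CommRing R] [Fintype ι] [DecidableEq ι] [Fintype κ] [DecidableEq κ]

theorem isUnit_det_of_triangular (M : Matrix ι ι R) (key : ι → ℕ) (hdiag : ∀ i, IsUnit (M i i))
    (htri : ∀ i j, i ≠ j → key j ≤ key i → M i j = 0) : IsUnit M.det := by
  have hM : M.BlockTriangular key := fun i j hij => htri i j (fun e => hij.ne (e ▸ rfl)) hij.le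
  rw [hM.det]
  refine IsUnit.prod_iff.2 fun k _ => ?_
  have hblock : M.toSquareBlock key k = diagonal fun i : {i // key i = k} => M i i := by
    ext i j
    rcases eq_or_ne i j with rfl | hij
    · simp [toSquareBlock_def]
    · rw [diagonal_apply_ne _ hij]
      exact htri i j (Subtype.coe_ne_coe.2 hij) (by rw [i.2, j.2])
  rw [hblock, det_diagonal]
  exact IsUnit.prod_iff.2 fun i _ => hdiag i

theorem isUnit_det_compRingEquiv (Y : Matrix ι ι (Matrix κ κ R)) (σ : Equiv.Perm ι) (key : ι → ℕ)
    {u : ι → R} (hu : ∀ i, IsUnit (u i)) (hdiag : ∀ i, Y i (σ i) = u i • 1)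
    (htri : ∀ i j, i ≠ j → key j ≤ key i → Y i (σ j) = 0) :
    IsUnit (compRingEquiv ι κ R Y).det := by
  have hdet : IsUnit ((compRingEquiv ι κ R Y).submatrix id (σ.prodCongr (Equiv.refl κ))).det := by
    refine isUnit_det_of_triangular _ (fun p => key p.1) ?_ ?_
    · rintro ⟨i, c⟩
      change IsUnit (Y i (σ i) c c)
      simpa [hdiag] using hu i
    · rintro ⟨i, c⟩ ⟨j, d⟩ hne hkey
      change Y i (σ j) c d = 0
      by_cases hij : i = j
      · subst hij
        have hcd : c ≠ d := fun e => hne (by rw [e])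
        simp [hdiag, hcd]
      · rw [htri i j hij hkey, Matrix.zero_apply]
  rw [det_permute'] at hdet
  exact isUnit_of_mul_isUnit_right hdet

theorem isUnit_det_updateCol_one (f : ι → Matrix κ κ R) (i₀ : ι) (hf : f i₀ = 1) :
    IsUnit (compRingEquiv ι κ R (updateCol 1 i₀ f)).det := by
  refine isUnit_det_compRingEquiv _ 1 (fun i => if i = i₀ then 1 else 0) (u := 1)
    (fun _ => isUnit_one) (fun i => ?_) fun i j hij hkey => ?_
  · by_cases hi : i = i₀ <;> simp [hi, hf]
  · have hj : j ≠ i₀ := by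
      rintro rfl
      simp [hij] at hkey
    simp [hj, hij]

theorem mul_updateCol_one {S : Type*} [Ring S] (Z : Matrix ι ι S) (f : ι → S) (i₀ : ι) (P : S)
    (hf : ∀ i, ∑ k, Z i k * f k = if i = i₀ then P else 0) :
    Z * updateCol 1 i₀ f =
      updateCol Z i₀ (Pi.single i₀ 1) * diagonal fun i => if i = i₀ then P else 1 := by
  ext i j
  rw [mul_diagonal, mul_apply]
  by_cases hj : j = i₀
  · subst hj
    simp [hf, Pi.single_apply]
  · simp [hj, one_apply]

end TriangularDeterminants

section UnimodularEquivalence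

/-- The involution of the levels that exchanges `2 j - 1` and `2 j`, and fixes `0` and an odd
top level. It moves the off-diagonal units of `theta` to the diagonal. -/
def swapLevel (m k : ℕ) : ℕ :=
  if k % 2 = 1 then (if k + 1 = m then k else k + 1) else k - 1

theorem swapLevel_lt {m k : ℕ} (hk : k < m) : swapLevel m k < m := by
  grind [swapLevel]

theorem swapLevel_swapLevel {m k : ℕ} (hk : k < m) : swapLevel m (swapLevel m k) = k := by
  grind [swapLevel]

/-- The permutation of the blocks that realizes `swapLevel`. -/
def swapPerm (m : ℕ) : Equiv.Perm (Fin m) :=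
  Function.Involutive.toPerm (fun p => (⟨swapLevel m p.rev, swapLevel_lt p.rev.2⟩ : Fin m).rev)
    fun p => by
      rw [← Fin.rev_inj, Fin.ext_iff]
      simp only [Fin.rev_rev]
      exact swapLevel_swapLevel p.rev.2

theorem rev_swapPerm {m : ℕ} (p : Fin m) : ((swapPerm m p).rev : ℕ) = swapLevel m p.rev := by
  change ((Fin.rev (Fin.rev _) : Fin m) : ℕ) = _
  rw [Fin.rev_rev]

/-- The order of the levels (even ones increasing, then odd ones decreasing) in which `theta`,
with its columns permuted by `swapLevel`, is triangular. -/
def levelRank (m k : ℕ) : ℕ := if k % 2 = 0 then k else 2 * m - k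

variable {R : Type*} [CommRing R] {m n : ℕ} (s : R)

theorem theta_swapLevel_self {M : Type*} [Ring M] [Algebra R M] (a : ℕ → M) {k : ℕ}
    (hk : k ≠ 0) : theta m s 1 a k (swapLevel m k) = (-1 : R) • 1 := by
  grind [theta, swapLevel]

theorem theta_swapLevel_of_levelRank_le {M : Type*} [Ring M] [Algebra R M] (a : ℕ → M) {k l : ℕ}
    (hk : k < m) (hl : l < m) (hl0 : l ≠ 0) (hkl : k ≠ l)
    (hrank : levelRank m l ≤ levelRank m k) : theta m s 1 a k (swapLevel m l) = 0 := by
  revert hrank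
  unfold theta swapLevel levelRank
  split_ifs <;> first | (intro; rfl) | omega

variable (a : ℕ → Matrix (Fin n) (Fin n) R) (p₀ : Fin m)

theorem isUnit_det_updateCol_theta (hp₀ : (p₀.rev : ℕ) = 0) :
    IsUnit (compRingEquiv (Fin m) (Fin n) R
      (updateCol (ofLevels m (theta m s 1 a)) p₀ (Pi.single p₀ 1))).det := by
  have hlevel : ∀ p : Fin m, p = p₀ ↔ (p.rev : ℕ) = 0 := fun p => by
    rw [← hp₀, ← Fin.ext_iff, Fin.rev_inj]
  have hswap : ∀ p, swapPerm m p = p₀ ↔ (p.rev : ℕ) = 0 := fun p => by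
    rw [hlevel, rev_swapPerm]
    grind [swapLevel]
  refine isUnit_det_compRingEquiv _ (swapPerm m) (fun p => levelRank m p.rev)
    (u := fun p => if p = p₀ then 1 else -1) (fun p => by split_ifs <;> simp) (fun p => ?_)
    fun p q hpq hrank => ?_
  · by_cases hp : p = p₀
    · rw [(hswap p).2 ((hlevel p).1 hp), updateCol_self, hp, Pi.single_eq_same, if_pos rfl,
        one_smul]
    · have hp' := (hlevel p).not.1 hp
      rw [updateCol_ne ((hswap p).not.2 hp'), if_neg hp, ofLevels, of_apply, rev_swapPerm,
        theta_swapLevel_self s a hp']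
  · by_cases hq : q = p₀
    · rw [(hswap q).2 ((hlevel q).1 hq), updateCol_self, Pi.single_eq_of_ne (hq ▸ hpq)]
    · have hq' := (hlevel q).not.1 hq
      rw [updateCol_ne ((hswap q).not.2 hq'), ofLevels, of_apply, rev_swapPerm]
      exact theta_swapLevel_of_levelRank_le s a p.rev.2 q.rev.2 hq'
        (by rwa [Ne, ← Fin.ext_iff, Fin.rev_inj]) hrank

theorem diagLast_eq {R : Type} [CommRing R] (hp₀ : (p₀.rev : ℕ) = 0)
    (X : Matrix (Fin n) (Fin n) R) : diagLast m X =
      compRingEquiv (Fin m) (Fin n) R (diagonal fun p => if p = p₀ then X else 1) := by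
  ext ⟨p, c⟩ ⟨q, d⟩
  have hp : (p : ℕ) + 1 = m ↔ p = p₀ := by
    rw [← Fin.rev_inj, Fin.ext_iff, hp₀, Fin.val_rev]
    omega
  change (if p = q then (if (p : ℕ) + 1 = m then X else 1) c d else 0) =
    (diagonal fun p => if p = p₀ then X else 1) p q c d
  simp only [hp, diagonal_apply]
  split_ifs <;> rfl

theorem diagLast_eq_submatrix {R : Type} [CommRing R] (hp₀ : (p₀.rev : ℕ) = 0) (p₁ : Fin m)
    (X : Matrix (Fin n) (Fin n) R) : diagLast m X =
      (compRingEquiv (Fin m) (Fin n) R (diagonal fun p => if p = p₁ then X else 1)).submatrix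
        ((Equiv.swap p₀ p₁).prodCongr (Equiv.refl _))
        ((Equiv.swap p₀ p₁).prodCongr (Equiv.refl _)) := by
  have hdiag : (diagonal fun p => if p = p₁ then X else 1).submatrix (Equiv.swap p₀ p₁)
      (Equiv.swap p₀ p₁) = diagonal fun p => if p = p₀ then X else 1 := by
    rw [submatrix_diagonal_equiv]
    simp only [Function.comp_def, Equiv.swap_apply_eq_iff, Equiv.swap_apply_right]
  rw [diagLast_eq p₀ hp₀, ← hdiag]
  rfl

/-- The block column with `W` in the block `p₀`. -/
def blockCol {κ : Type*} (W : Matrix (Fin n) κ R) : Matrix (Fin m × Fin n) κ R :=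
  of fun p j => if p.1 = p₀ then W p.2 j else 0

/-- The block row with `W` in the block `p₀`. -/
def blockRow {κ : Type*} (W : Matrix κ (Fin n) R) : Matrix κ (Fin m × Fin n) R :=
  of fun i p => if p.1 = p₀ then W i p.2 else 0

variable {κ : Type*} (Y : Matrix (Fin m) (Fin m) (Matrix (Fin n) (Fin n) R))

theorem comp_mul_blockCol {p₁ : Fin m} (hY : ∀ p, Y p p₀ = if p = p₁ then 1 else 0)
    (W : Matrix (Fin n) κ R) :
    compRingEquiv (Fin m) (Fin n) R Y * blockCol p₀ W = blockCol p₁ W := by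
  ext ⟨p, c⟩ j
  have hentry : ∀ d, compRingEquiv (Fin m) (Fin n) R Y (p, c) (p₀, d) = Y p p₀ c d := fun _ => rfl
  rw [mul_apply, Fintype.sum_prod_type, Finset.sum_eq_single p₀
    (fun q _ hq => by simp [blockCol, hq]) (by simp)]
  simp only [hentry, hY, blockCol, of_apply, if_true]
  split_ifs <;> simp [one_apply]

theorem blockRow_mul_comp (hY : ∀ p, Y p₀ p = if p = p₀ then 1 else 0)
    (W : Matrix κ (Fin n) R) :
    blockRow p₀ W * compRingEquiv (Fin m) (Fin n) R Y = blockRow p₀ W := by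
  ext i ⟨p, c⟩
  have hentry : ∀ d, compRingEquiv (Fin m) (Fin n) R Y (p₀, d) (p, c) = Y p₀ p d c := fun _ => rfl
  rw [mul_apply, Fintype.sum_prod_type, Finset.sum_eq_single p₀
    (fun q _ hq => by simp [blockRow, hq]) (by simp)]
  simp only [hentry, hY, blockRow, of_apply, if_true]
  split_ifs <;> simp [one_apply]

theorem blockCol_mul {ν : Type*} [Fintype κ] (W : Matrix (Fin n) κ R) (M : Matrix κ ν R) :
    blockCol p₀ W * M = blockCol p₀ (W * M) := by
  ext p j
  simp only [mul_apply, blockCol, of_apply]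
  split_ifs <;> simp

theorem mul_blockRow {ν : Type*} [Fintype κ] (M : Matrix ν κ R) (W : Matrix κ (Fin n) R) :
    M * blockRow p₀ W = blockRow p₀ (M * W) := by
  ext i p
  simp only [mul_apply, blockRow, of_apply]
  split_ifs <;> simp

theorem map_blockCol {S : Type*} [CommRing S] (φ : R →+* S) (W : Matrix (Fin n) κ R) :
    (blockCol p₀ W).map φ = blockCol p₀ (W.map φ) := by
  ext p j
  exact (apply_ite φ _ _ _).trans (by rw [map_zero]; rfl)

theorem map_blockRow {S : Type*} [CommRing S] (φ : R →+* S) (W : Matrix κ (Fin n) R) :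
    (blockRow p₀ W).map φ = blockRow p₀ (W.map φ) := by
  ext i p
  exact (apply_ite φ _ _ _).trans (by rw [map_zero]; rfl)

theorem exists_equiv_diagLast {R : Type} [CommRing R] (s : R) (a : ℕ → Matrix (Fin n) (Fin n) R)
    (hp₀ : (p₀.rev : ℕ) = 0) : ∃ U V : Matrix (Fin m × Fin n) (Fin m × Fin n) R,
      IsUnit U.det ∧ IsUnit V.det ∧
      U * compRingEquiv (Fin m) (Fin n) R (ofLevels m (theta m s 1 a)) * V =
        diagLast m (hornerUp m s a 0) ∧
      (∀ (κ : Type) (W : Matrix (Fin n) κ R), U * blockCol p₀ W = blockCol p₀ W) ∧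
      (∀ (κ : Type) (W : Matrix κ (Fin n) R), blockRow p₀ W * V = blockRow p₀ W) := by
  set Y := updateCol (ofLevels m (theta m s 1 a)) p₀ (Pi.single p₀ 1) with hY
  set f : Fin m → Matrix (Fin n) (Fin n) R := fun p => colUp m s a p.rev with hf
  have hf₀ : f p₀ = 1 := by simp only [hf, hp₀, colUp]; simp
  have hYdet := isUnit_det_updateCol_theta s a p₀ hp₀
  have hYinv := nonsing_inv_mul _ hYdet
  have hYV : ofLevels m (theta m s 1 a) * updateCol 1 p₀ f =
      Y * diagonal fun p => if p = p₀ then hornerUp m s a 0 else 1 := by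
    refine mul_updateCol_one _ f p₀ _ fun p => ?_
    have hcol := sum_theta_mul_colUp m s a p.rev.2
    rw [Finset.sum_range (fun l => theta m s 1 a p.rev l * colUp m s a l),
      ← Equiv.sum_comp Fin.revPerm] at hcol
    have hp : p = p₀ ↔ (p.rev : ℕ) = 0 := by rw [← hp₀, ← Fin.ext_iff, Fin.rev_inj]
    simp only [hp]
    exact hcol
  refine ⟨(compRingEquiv (Fin m) (Fin n) R Y)⁻¹, compRingEquiv (Fin m) (Fin n) R
    (updateCol 1 p₀ f), isUnit_nonsing_inv_det _ hYdet, isUnit_det_updateCol_one f p₀ hf₀,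
    ?_, fun κ W => ?_, fun κ W => ?_⟩
  · rw [mul_assoc, ← map_mul, hYV, map_mul, ← mul_assoc, hYinv, one_mul, diagLast_eq p₀ hp₀]
  · conv_lhs => rw [← comp_mul_blockCol p₀ Y (fun p => by
      rw [hY, updateCol_self, Pi.single_apply]) W]
    rw [← Matrix.mul_assoc, hYinv, Matrix.one_mul]
  · refine blockRow_mul_comp p₀ _ (fun p => ?_) W
    by_cases hp : p = p₀ <;> simp [hp, hf₀, one_apply, eq_comm (a := p₀)]

end UnimodularEquivalence

section Tracking

/-- The level at which a block column `e ⊗ C` of level `s` arrives when it is multiplied by the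
elementary matrices with indices in `t`, read from right to left: the factor of index `s + 1` moves
it from level `s` to level `s + 1`. -/
def track (s : ℤ) : List ℤ → ℤ
  | [] => s
  | i :: t => if i = track s t + 1 then i else track s t

/-- No factor of the product acts nontrivially on the diagonal block at the current level of the
tracked column, so that `track` describes its motion. -/
def Avoids (s : ℤ) : List ℤ → Prop
  | [] => True
  | i :: t => i ≠ track s t ∧ Avoids s t

theorem track_append (s : ℤ) (t u : List ℤ) : track s (t ++ u) = track (track s u) t := by
  induction t with
  | nil => rfl
  | cons i t ih => simp only [List.cons_append, track, ih]

theorem avoids_append {s : ℤ} {t u : List ℤ} :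
    Avoids s (t ++ u) ↔ Avoids (track s u) t ∧ Avoids s u := by
  induction t with
  | nil => simp only [List.nil_append, Avoids, true_and]
  | cons i t ih => simp only [List.cons_append, Avoids, track_append, ih, and_assoc]

theorem le_track (s : ℤ) (t : List ℤ) : s ≤ track s t := by
  induction t with
  | nil => rfl
  | cons i t ih => grind [track]

theorem track_le_add_length (s : ℤ) (t : List ℤ) : track s t ≤ s + t.length := by
  induction t with
  | nil => simp [track]
  | cons i t ih => grind [track]

theorem reverse_str_zero_sublist_iff (t : List ℤ) (s : ℕ) :
    (str 0 s).reverse.Sublist t ↔ (s : ℤ) ≤ track (-1) t := by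
  induction t generalizing s with
  | nil =>
    rw [List.sublist_nil, List.reverse_eq_nil_iff, str_cons (by omega)]
    simp only [reduceCtorEq, track, false_iff]
    omega
  | cons i t ih =>
    have htrack := le_track (-1) t
    obtain _ | s := s
    · have hzero : (str 0 (0 : ℕ)).reverse = [0] := by
        rw [Nat.cast_zero, str_self, List.reverse_singleton]
      have hmem := ih 0
      rw [hzero, List.singleton_sublist] at hmem ⊢
      rw [List.mem_cons, hmem, track]
      split_ifs <;> omega
    · have hcons : (str 0 (s + 1 : ℕ)).reverse = ((s : ℤ) + 1) :: (str 0 s).reverse := by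
        rw [Nat.cast_succ, str_concat (by omega), List.reverse_append, List.reverse_singleton,
          List.singleton_append]
      by_cases hi : i = s + 1
      · rw [hcons, hi, List.cons_sublist_cons, ih, track]
        push_cast
        split_ifs <;> omega
      · rw [hcons, List.sublist_cons_iff, ← hcons, ih, track]
        grind

theorem inversionsAt_zero (t : List ℤ) : inversionsAt 0 t = track (-1) t := by
  have hmem : 0 ∈ t ↔ 0 ≤ track (-1) t := by
    simpa [str_self] using reverse_str_zero_sublist_iff t 0
  have hle := le_track (-1) t
  have hge := track_le_add_length (-1) t
  unfold inversionsAt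
  split_ifs with h
  · rw [hmem] at h
    have hfind : Nat.findGreatest (fun s : ℕ => (str 0 (0 + s)).reverse.Sublist t) t.length =
        (track (-1) t).toNat := by
      rw [Nat.findGreatest_eq_iff]
      simp only [zero_add, reverse_str_zero_sublist_iff]
      exact ⟨by omega, fun _ => by omega, fun k _ _ => by omega⟩
    rw [hfind]
    omega
  · rw [hmem] at h
    omega

theorem avoids_and_track_str {s a b : ℤ} (h : b ≠ s) :
    Avoids s (str a b) ∧ track s (str a b) = if a ≤ s + 1 ∧ s < b then s + 1 else s := by
  obtain ⟨d, hd⟩ : ∃ d : ℕ, (b + 1 - a).toNat = d := ⟨_, rfl⟩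
  induction d generalizing a with
  | zero =>
    rw [str_of_lt (by omega), if_neg (by omega)]
    exact ⟨trivial, rfl⟩
  | succ d ih =>
    obtain ⟨havoids, htrack⟩ := ih (a := a + 1) (by omega)
    rw [str_cons (by omega)]
    simp only [Avoids, track, htrack, havoids, and_true]
    grind

theorem IsCanonical.exists_append {h : ℕ} {t : List ℤ} (ht : IsCanonical (h + 2) t) :
    ∃ (c : ℕ) (u : List ℤ), IsCanonical h u ∧ t = str c h ++ u := by
  obtain ⟨c, rfl⟩ := ht
  refine ⟨c 0, _, ⟨fun k => c (k + 1), rfl⟩, ?_⟩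
  rw [show (h + 2) / 2 = h / 2 + 1 by omega, List.range_succ_eq_map, List.flatMap_cons,
    List.flatMap_map]
  congr 2
  · push_cast; ring
  · ext1 k
    congr 1
    push_cast; ring

theorem IsCanonical.eq_nil {t : List ℤ} (ht : IsCanonical 0 t) : t = [] := by
  obtain ⟨c, rfl⟩ := ht
  rfl

theorem IsCanonical.mem_bounds {h : ℕ} {t : List ℤ} (ht : IsCanonical h t) {i : ℤ} (hi : i ∈ t) :
    0 ≤ i ∧ i + 2 ≤ h := by
  obtain ⟨c, rfl⟩ := ht
  obtain ⟨k, -, hi⟩ := List.mem_flatMap.1 hi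
  rw [mem_str] at hi
  omega

theorem IsCanonical.avoids_and_track_le (q : ℕ) {t : List ℤ} (ht : IsCanonical (2 * q) t) :
    Avoids 1 t ∧ track 1 t ≤ max q 1 := by
  induction q generalizing t with
  | zero => simp [ht.eq_nil, Avoids, track]
  | succ q ih =>
    obtain ⟨c, u, hu, rfl⟩ := ht.exists_append
    obtain ⟨havoids, htrack⟩ := ih hu
    have hle := le_track 1 u
    obtain ⟨havoids', htrack'⟩ := avoids_and_track_str (s := track 1 u) (a := c) (b := (2 * q : ℕ))
      (by omega)
    rw [show Nat.mul 2 q = 2 * q from rfl] at *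
    rw [avoids_append, track_append, htrack']
    grind

theorem track_simpleTuple (q : ℕ) :
    track (-1) (simpleTuple (2 * q)) = if q = 0 then 0 else 1 := by
  induction q with
  | zero => simp [simpleTuple_zero, track]
  | succ q ih =>
    rw [show 2 * (q + 1) = 2 * q + 2 by ring, simpleTuple_add_two]
    grind [track]

theorem avoids_and_track_altTuple (q : ℕ) :
    Avoids 0 (altTuple (2 * q - 1)) ∧ track 0 (altTuple (2 * q - 1)) = if q = 0 then 0 else 1 := by
  induction q with
  | zero => simp [altTuple, track, Avoids]
  | succ q ih =>
    rw [show 2 * (q + 1) - 1 = 2 * q + 1 by omega, altTuple_succ]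
    grind [Avoids, track]

theorem exists_track_altTuple {h : ℕ} (hh : Even h) {t : List ℤ} (ht : IsCanonical h t) :
    ∃ s : ℤ, 0 ≤ s ∧ s ≤ h ∧ Avoids 0 (altTuple (h - 1)) ∧ track 0 (altTuple (h - 1)) = s ∧
      Avoids s t ∧ track s t = inversionsAt 0 (t ++ simpleTuple h) ∧ track s t ≤ h := by
  obtain ⟨q, rfl⟩ := hh
  rw [← two_mul] at *
  obtain ⟨havoids, htrack⟩ := avoids_and_track_altTuple q
  rw [inversionsAt_zero, track_append, track_simpleTuple]
  refine ⟨_, ?_, ?_, havoids, htrack, ?_⟩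
  · split_ifs <;> omega
  · split_ifs <;> omega
  · obtain rfl | hq := eq_or_ne q 0
    · simp [ht.eq_nil, Avoids, track]
    · rw [if_neg hq]
      obtain ⟨havoids, hle⟩ := ht.avoids_and_track_le
      exact ⟨havoids, rfl, by omega⟩

end Tracking

section ColumnMotion
variable {m n r : ℕ} {κ : Type*}

theorem colKron_eq_blockCol (p : Fin m) (W : Matrix (Fin n) (Fin r) ℂ) :
    colKron m (m - p.rev) W = blockCol p W := by
  ext ⟨q, c⟩ j
  have h : ((q : ℕ) : ℤ) + 1 = m - p.rev ↔ q = p := by rw [Fin.val_rev]; omega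
  simp only [colKron, blockCol, of_apply, h]

theorem colKron_self_eq_blockCol {p : Fin m} (hp : (p.rev : ℕ) = 0)
    (W : Matrix (Fin n) (Fin r) ℂ) : colKron m m W = blockCol p W := by
  rw [← colKron_eq_blockCol, hp, Nat.cast_zero, sub_zero]

theorem rowKron_eq_blockRow (p : Fin m) (W : Matrix (Fin r) (Fin n) ℂ) :
    rowKron m (m - p.rev) W = blockRow p W :=
  Matrix.transpose_injective (colKron_eq_blockCol p Wᵀ)

theorem rowKron_self_eq_blockRow {p : Fin m} (hp : (p.rev : ℕ) = 0)
    (W : Matrix (Fin r) (Fin n) ℂ) : rowKron m m W = blockRow p W :=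
  Matrix.transpose_injective (colKron_self_eq_blockCol hp Wᵀ)

theorem rowKron_transpose (k : ℤ) (B : Matrix (Fin r) (Fin n) ℂ) :
    (rowKron m k B)ᵀ = colKron m k Bᵀ := rfl

theorem elemM_mul_blockCol_of_notMem {i : ℤ} {p : Fin m} (hp : p ∉ levelSupport m i)
    (X : Matrix (Fin n) (Fin n) ℂ) (W : Matrix (Fin n) κ ℂ) :
    elemM m i X * blockCol p W = blockCol p W := by
  rw [← comp_elemBlock]
  exact comp_mul_blockCol _ _ (fun q => by
    rw [isLocal_elemBlock i X q p (Or.inr hp), one_apply]) W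

theorem elemM_mul_blockCol_of_succ {p p₁ : Fin m} (hp : (p₁.rev : ℕ) = p.rev + 1)
    (X : Matrix (Fin n) (Fin n) ℂ) (W : Matrix (Fin n) κ ℂ) :
    elemM m p₁.rev X * blockCol p W = blockCol p₁ W := by
  rw [← comp_elemBlock]
  refine comp_mul_blockCol _ _ (fun q => ?_) W
  simp only [of_apply, elemBlock, ← Fin.val_inj, Fin.val_rev] at hp ⊢
  split_ifs <;> first | rfl | omega

theorem prodM_cons (i : ℤ) (t : List ℤ) (X : Matrix (Fin n) (Fin n) ℂ)
    (𝒳 : List (Matrix (Fin n) (Fin n) ℂ)) :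
    prodM m (i :: t) (X :: 𝒳) = elemM m i X * prodM m t 𝒳 := by
  rw [prodM, List.zipWith_cons_cons, List.prod_cons, prodM]

theorem prodM_append {t u : List ℤ} {𝒳 𝒴 : List (Matrix (Fin n) (Fin n) ℂ)}
    (h : 𝒳.length = t.length) : prodM m (t ++ u) (𝒳 ++ 𝒴) = prodM m t 𝒳 * prodM m u 𝒴 := by
  rw [prodM, List.zipWith_append h.symm, List.prod_append, prodM, prodM]

theorem prodP_eq_prodM (a : ℕ → Matrix (Fin n) (Fin n) ℂ) (t : List ℤ) :
    prodP m a t = prodM m t (t.map fun i => if 0 ≤ i then -a i.natAbs else a i.natAbs) := by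
  rw [prodM, List.zipWith_map_right, List.zipWith_self]
  rfl

theorem prodM_mul_blockCol_of_notMem {p : Fin m} (t : List ℤ)
    (ht : ∀ i ∈ t, p ∉ levelSupport m i) (𝒳 : List (Matrix (Fin n) (Fin n) ℂ))
    (W : Matrix (Fin n) κ ℂ) : prodM m t 𝒳 * blockCol p W = blockCol p W := by
  induction t generalizing 𝒳 with
  | nil => rw [prodM, List.zipWith_nil_left, List.prod_nil, Matrix.one_mul]
  | cons i t ih =>
    rw [List.forall_mem_cons] at ht
    obtain _ | ⟨X, 𝒳⟩ := 𝒳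
    · rw [prodM, List.zipWith_nil_right, List.prod_nil, Matrix.one_mul]
    · rw [prodM_cons, Matrix.mul_assoc, ih ht.2, elemM_mul_blockCol_of_notMem ht.1]

theorem prodM_mul_blockCol (p : Fin m) {t : List ℤ} (ht : ∀ i ∈ t, 0 ≤ i ∧ i < m)
    (hav : Avoids p.rev t) {𝒳 : List (Matrix (Fin n) (Fin n) ℂ)} (hl : 𝒳.length = t.length)
    (W : Matrix (Fin n) κ ℂ) : ∃ p₁ : Fin m, (p₁.rev : ℤ) = track p.rev t ∧
      prodM m t 𝒳 * blockCol p W = blockCol p₁ W := by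
  induction t generalizing 𝒳 with
  | nil => exact ⟨p, rfl, by rw [prodM, List.zipWith_nil_left, List.prod_nil, Matrix.one_mul]⟩
  | cons i t ih =>
    obtain ⟨X, 𝒳, rfl⟩ := List.exists_cons_of_length_eq_add_one hl
    rw [List.forall_mem_cons] at ht
    obtain ⟨p₁, hp₁, hmul⟩ := ih ht.2 hav.2 (Nat.succ_injective hl)
    have hne : i ≠ p₁.rev := hp₁ ▸ hav.1
    rw [prodM_cons, Matrix.mul_assoc, hmul, track, ← hp₁]
    split_ifs with hi
    · obtain ⟨p₂, hp₂⟩ : ∃ p₂ : Fin m, (p₂.rev : ℤ) = i :=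
        ⟨Fin.rev ⟨i.toNat, by omega⟩, by rw [Fin.rev_rev]; exact Int.toNat_of_nonneg ht.1.1⟩
      refine ⟨p₂, hp₂, ?_⟩
      rw [← hp₂, elemM_mul_blockCol_of_succ (by omega)]
    · refine ⟨p₁, rfl, elemM_mul_blockCol_of_notMem (fun h => ?_) X W⟩
      simp only [levelSupport, Set.mem_ofPred_eq] at h
      omega

theorem prodM_transpose {t : List ℤ} {𝒳 : List (Matrix (Fin n) (Fin n) ℂ)}
    (hl : 𝒳.length = t.length) (hs : ∀ M ∈ 𝒳, M.IsSymm) :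
    (prodM m t 𝒳)ᵀ = prodM m t.reverse 𝒳.reverse := by
  induction t generalizing 𝒳 with
  | nil => simp [prodM]
  | cons i t ih =>
    obtain ⟨X, 𝒳, rfl⟩ := List.exists_cons_of_length_eq_add_one hl
    rw [List.forall_mem_cons] at hs
    have hl' : 𝒳.length = t.length := Nat.succ_injective hl
    rw [prodM_cons, transpose_mul, ih hl' hs.2, elemM_transpose, hs.1.eq, List.reverse_cons,
      List.reverse_cons, prodM_append (by rw [List.length_reverse, List.length_reverse, hl']),
      prodM_cons, prodM, prodM, List.zipWith_nil_left, List.prod_nil, Matrix.mul_one]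

theorem det_prodM_ne_zero {t : List ℤ} {𝒳 : List (Matrix (Fin n) (Fin n) ℂ)}
    (h : IsNonsingularAssignment m t 𝒳) : (prodM m t 𝒳).det ≠ 0 := by
  obtain ⟨-, h⟩ := h
  rw [prodM, ← List.map_uncurry_zip_eq_zipWith, ← coe_detMonoidHom, map_list_prod, List.map_map]
  refine List.prod_ne_zero fun h0 => ?_
  obtain ⟨⟨i, X⟩, hx, h0⟩ := List.mem_map.1 h0
  exact det_elemM_ne_zero i X (h _ hx) h0

end ColumnMotion

section BlockStructure
variable {m n r : ℕ}

/-- `M ↦ diag(M, I_r)` as a monoid homomorphism, which carries `M_t` to `𝕄_t`. -/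
def extendHom (m n r : ℕ) : Matrix (Fin m × Fin n) (Fin m × Fin n) ℂ →*
    Matrix ((Fin m × Fin n) ⊕ Fin r) ((Fin m × Fin n) ⊕ Fin r) ℂ where
  toFun := extendOne r
  map_one' := fromBlocks_one
  map_mul' M N := by simp [extendOne, fromBlocks_multiply]

theorem prodMM_eq (t : List ℤ) (𝒳 : List (Matrix (Fin n) (Fin n) ℂ)) :
    prodMM m r t 𝒳 = extendOne r (prodM m t 𝒳) := by
  rw [prodMM, prodM, ← List.map_zipWith (f := extendOne r)]
  exact (map_list_prod (extendHom m n r) _).symm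

variable (a : ℕ → Matrix (Fin n) (Fin n) ℂ)

theorem prodPP_eq (t : List ℤ) : prodPP m r a t = extendOne r (prodP m a t) := by
  rw [prodPP, prodP, ← Function.comp_def (extendOne r), ← List.map_map]
  exact (map_list_prod (extendHom m n r) _).symm

variable (A : Matrix (Fin r) (Fin r) ℂ) (B : Matrix (Fin r) (Fin n) ℂ)
  (C : Matrix (Fin n) (Fin r) ℂ) (E : Matrix (Fin r) (Fin r) ℂ)

theorem fiedlerS_of_natAbs_lt {i : ℤ} (h0 : i ≠ 0) (hi : i.natAbs < m) :
    fiedlerS m a A B C E i = extendOne r (fiedlerP m a i) := by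
  rw [fiedlerS, if_neg h0, if_neg (by omega), ite_eq_left_iff]
  refine fun _ => Matrix.inv_eq_left_inv ?_
  rw [← map_one (extendHom m n r), ← fiedlerP_mul_fiedlerP_neg m a h0 hi]
  exact (map_mul (extendHom m n r) _ _).symm

theorem prodSS_of_natAbs_lt {t : List ℤ} (ht : ∀ i ∈ t, i ≠ 0 ∧ i.natAbs < m) :
    prodSS m a A B C E t = extendOne r (prodP m a t) := by
  rw [← prodPP_eq, prodSS, prodPP]
  exact congrArg _ (List.map_congr_left fun i hi => fiedlerS_of_natAbs_lt a A B C E (ht i hi).1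
    (ht i hi).2)

theorem prodSS_shift_simpleTuple {k : ℕ} (hk : k < m) :
    prodSS m a A B C E (shift (-m) (simpleTuple k)) =
      fromBlocks (prodP m a (shift (-m) (simpleTuple k))) 0 0 (-E) := by
  obtain ⟨s, t, hst, hbound⟩ := exists_simpleTuple_eq_append k
  have hS : fiedlerS m a A B C E (-m) = fromBlocks (fiedlerP m a (-m)) 0 0 (-E) := by
    rw [fiedlerS, if_neg (by omega), if_pos rfl]
  have hs : ∀ i ∈ shift (-m) s, i ≠ 0 ∧ i.natAbs < m := fun i hi => by
    have := hbound _ (List.mem_append_left t (mem_shift.1 hi))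
    omega
  have ht : ∀ i ∈ shift (-m) t, i ≠ 0 ∧ i.natAbs < m := fun i hi => by
    have := hbound _ (List.mem_append_right s (mem_shift.1 hi))
    omega
  have hshift : shift (-m) (simpleTuple k) = shift (-m) s ++ [-(m : ℤ)] ++ shift (-m) t := by
    simp [hst, shift]
  have hprod : prodSS m a A B C E (shift (-m) (simpleTuple k)) =
      prodSS m a A B C E (shift (-m) s) * fiedlerS m a A B C E (-m) *
        prodSS m a A B C E (shift (-m) t) := by
    simp only [hshift, prodSS, List.map_append, List.prod_append, List.map_singleton,
      List.prod_singleton]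
  rw [hprod, prodSS_of_natAbs_lt a A B C E hs, prodSS_of_natAbs_lt a A B C E ht, hS, hshift,
    prodP_append, prodP_append, prodP_singleton, extendOne, extendOne, fromBlocks_multiply,
    fromBlocks_multiply]
  simp

theorem prodSS_simpleTuple {q : ℕ} (hq : 2 * q < m) :
    prodSS m a A B C E (simpleTuple (2 * q)) =
      fromBlocks (prodP m a (simpleTuple (2 * q)))
        (-(prodP m a (altTuple (2 * q - 1)) * prodP m a (altTuple (2 * q)) * colKron m m C))
        (-rowKron m m B) (-A) := by
  have hlt (k : ℕ) (hk : k < m) : ∀ i ∈ altTuple k, i ≠ 0 ∧ i.natAbs < m := fun i hi => by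
    rw [mem_altTuple] at hi; omega
  have hfar (i j : ℤ) (h₁ : 1 ≤ i) (h₂ : i + 2 ≤ j) : Far i j := by unfold Far; omega
  have hP : prodP m a (simpleTuple (2 * q)) =
      prodP m a (altTuple (2 * q - 1)) * prodP m a (altTuple (2 * q)) * fiedlerP m a 0 :=
    prod_map_simpleTuple_two_mul _ q fun i j h₁ h₂ _ => fiedlerP_commute m a (hfar i j h₁ h₂)
  have hS : prodSS m a A B C E (simpleTuple (2 * q)) =
      prodSS m a A B C E (altTuple (2 * q - 1)) * prodSS m a A B C E (altTuple (2 * q)) *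
        fiedlerS m a A B C E 0 := by
    refine prod_map_simpleTuple_two_mul _ q fun i j h₁ h₂ h₃ => ?_
    rw [fiedlerS_of_natAbs_lt a A B C E (by omega) (by omega),
      fiedlerS_of_natAbs_lt a A B C E (by omega) (by omega)]
    exact (fiedlerP_commute m a (hfar i j h₁ h₂)).map (extendHom m n r)
  rw [hS, hP, prodSS_of_natAbs_lt a A B C E (hlt _ (by omega)),
    prodSS_of_natAbs_lt a A B C E (hlt _ hq), fiedlerS, if_pos rfl, extendOne, extendOne,
    fromBlocks_multiply, fromBlocks_multiply]
  simp

end BlockStructure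

section ConstantPolynomialMatrices
variable {ι κ : Type}

theorem cPoly_mul {ν : Type} [Fintype κ] (M : Matrix ι κ ℂ) (N : Matrix κ ν ℂ) :
    cPoly (M * N) = cPoly M * cPoly N :=
  Matrix.map_mul

theorem cPoly_neg (M : Matrix ι κ ℂ) : cPoly (-M) = -cPoly M :=
  Matrix.map_neg _ (map_neg _) M

theorem cPoly_zero : cPoly (0 : Matrix ι κ ℂ) = 0 :=
  Matrix.map_zero _ (map_zero _)

theorem cPoly_one [DecidableEq ι] : cPoly (1 : Matrix ι ι ℂ) = 1 :=
  Matrix.map_one _ (map_zero _) (map_one _)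

theorem cPoly_transpose (M : Matrix ι κ ℂ) : (cPoly M)ᵀ = cPoly Mᵀ := rfl

theorem cPoly_fromBlocks {ι' κ' : Type} (M : Matrix ι κ ℂ) (N : Matrix ι κ' ℂ)
    (K : Matrix ι' κ ℂ) (L : Matrix ι' κ' ℂ) :
    cPoly (fromBlocks M N K L) = fromBlocks (cPoly M) (cPoly N) (cPoly K) (cPoly L) :=
  fromBlocks_map ..

end ConstantPolynomialMatrices

section PencilFactorization
variable {m n h : ℕ} (a : ℕ → Matrix (Fin n) (Fin n) ℂ)

theorem prodP_isSymm (ha : ∀ j ≤ m, (a j).IsSymm) {t : List ℤ} (ht : ∀ i ∈ t, i.natAbs ≤ m)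
    (hfar : t.Pairwise Far) : (prodP m a t).IsSymm := by
  induction t with
  | nil => exact transpose_one
  | cons i t ih =>
    rw [List.forall_mem_cons] at ht
    rw [List.pairwise_cons] at hfar
    have hi : (fiedlerP m a i).IsSymm := by
      rw [IsSymm, fiedlerP, elemM_transpose]
      split_ifs
      · rw [(ha _ ht.1).neg.eq]
      · rw [(ha _ ht.1).eq]
    have hc : Commute (prodP m a [i]) (prodP m a t) := prodP_commute m a (by simpa using hfar.1)
    rw [← List.singleton_append, prodP_append, hc.eq, IsSymm, transpose_mul, prodP_singleton,
      hi.eq, (ih ht.2 hfar.2).eq, ← prodP_singleton, hc.eq]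

theorem prodP_mul_colKron_self {r : ℕ} (hm : 0 < m) {t : List ℤ} (ht : ∀ i ∈ t, 2 ≤ i.natAbs)
    (C : Matrix (Fin n) (Fin r) ℂ) : prodP m a t * colKron m m C = colKron m m C := by
  have hlast : ((Fin.rev ⟨0, hm⟩ : Fin m).rev : ℕ) = 0 := by rw [Fin.rev_rev]
  rw [colKron_self_eq_blockCol hlast, prodP_eq_prodM]
  refine prodM_mul_blockCol_of_notMem t (fun i hi h => ?_) _ C
  simp only [levelSupport, Set.mem_ofPred_eq, hlast] at h
  have := ht i hi
  omega

variable (m) in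
/-- The indices of the factors of `M_{c_v}^P` outside the outer factor: the symmetric complement
contains `-m` exactly when `m` is even. -/
def leadTuple : List ℤ := if Even m then [-(m : ℤ)] else []

variable (m h) in
/-- The left factor `N` of the congruence `L_P = N (λ 𝒪 - ℰ) D Nᵀ`, where `D` is the product
over `leadTuple`. -/
noncomputable def congruenceFactor (tw tv : List ℤ) (𝒳 𝒴 : List (Matrix (Fin n) (Fin n) ℂ)) :
    Matrix (Fin m × Fin n) (Fin m × Fin n) ℂ :=
  prodM m (tv ++ tw) (𝒴 ++ 𝒳) * outerFactor m a h

variable (hm : h < m)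
include hm

theorem outerFactor_isSymm (ha : ∀ j ≤ m, (a j).IsSymm) : (outerFactor m a h).IsSymm := by
  rw [outerFactor, ← prodP_append]
  refine prodP_isSymm a ha (fun i hi => ?_) (List.pairwise_append.2 ⟨?_, ?_, fun i hi j hj => ?_⟩)
  · rw [List.mem_append, mem_altTuple, mem_shift, mem_altTuple] at hi
    omega
  · exact (pairwise_altTuple _).imp_of_mem fun hi hj hij => by
      rw [mem_altTuple] at hi hj
      unfold Far
      omega
  · refine List.pairwise_map.2 ((pairwise_altTuple _).imp_of_mem fun hi hj hij => ?_)
    rw [mem_altTuple] at hi hj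
    unfold Far
    omega
  · rw [mem_altTuple] at hi
    rw [mem_shift, mem_altTuple] at hj
    unfold Far
    omega

theorem outerFactor_mul_colKron {r : ℕ} (C : Matrix (Fin n) (Fin r) ℂ) :
    outerFactor m a h * colKron m m C = prodP m a (altTuple (h - 1)) * colKron m m C := by
  rw [outerFactor, Matrix.mul_assoc, prodP_mul_colKron_self a (by omega) fun i hi => by
    rw [mem_shift, mem_altTuple] at hi; omega]

variable (hh : Even h)
include hh

theorem prodP_complement :
    prodP m a (simpleComplement h ++ shift (-m) (simpleComplement (m - h - 1))) =
      prodP m a (leadTuple m) * outerFactor m a h := by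
  have hv : shift (-m) (simpleComplement (m - h - 1)) =
      shift (-m) (altTuple (m - h - 1 - 1)) ++ leadTuple m := by
    have hodd : (m - h - 1) % 2 = 1 ↔ Even m := by grind
    rw [simpleComplement_eq, shift, List.map_append, leadTuple]
    simp only [hodd]
    split_ifs <;> simp [shift]
  have hc : Commute (outerFactor m a h) (prodP m a (leadTuple m)) := by
    rw [outerFactor, ← prodP_append]
    refine prodP_commute m a fun i hi j hj => ?_
    rw [List.mem_append, mem_altTuple, mem_shift, mem_altTuple] at hi
    unfold leadTuple at hj
    unfold Far
    split_ifs at hj with hmeven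
    · rw [List.mem_singleton] at hj
      grind
    · simp at hj
  rw [simpleComplement_of_even hh, hv, prodP_append, prodP_append, ← mul_assoc, ← outerFactor,
    hc.eq]

theorem prodP_evenTuple_mul_leadTuple_isSymm (ha : ∀ j ≤ m, (a j).IsSymm) :
    (prodP m a (evenTuple m h) * prodP m a (leadTuple m)).IsSymm := by
  rw [← prodP_append]
  refine prodP_isSymm a ha (fun i hi => ?_) (List.pairwise_append.2
    ⟨pairwise_far_evenTuple hh hm, ?_, fun i hi j hj => ?_⟩)
  · rw [List.mem_append, mem_evenTuple hh hm] at hi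
    grind [leadTuple]
  · unfold leadTuple
    split_ifs <;> simp
  · rw [mem_evenTuple hh hm] at hi
    grind [leadTuple, Far]

theorem prodP_oddTuple_mul_leadTuple_isSymm (ha : ∀ j ≤ m, (a j).IsSymm) :
    (fiedlerP m a (-m) * prodP m a (oddTuple m h) * prodP m a (leadTuple m)).IsSymm := by
  have hodd : (prodP m a (oddTuple m h)).IsSymm := prodP_isSymm a ha (fun i hi => by
    rw [mem_oddTuple hh hm] at hi; omega) (pairwise_far_oddTuple hh hm)
  have hlead : (fiedlerP m a (-m)).IsSymm := by
    rw [← prodP_singleton]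
    exact prodP_isSymm a ha (by simp) (List.pairwise_singleton _ _)
  by_cases hme : Even m
  · rw [leadTuple, if_pos hme, prodP_singleton, IsSymm, transpose_mul, transpose_mul, hodd.eq,
      hlead.eq, mul_assoc]
  · have hc : Commute (fiedlerP m a (-m)) (prodP m a (oddTuple m h)) := by
      rw [← prodP_singleton]
      refine prodP_commute m a fun i hi j hj => ?_
      rw [mem_oddTuple hh hm] at hj
      grind [Far]
    rw [leadTuple, if_neg hme, prodP, prodP, List.map_nil, List.prod_nil, mul_one, IsSymm,
      transpose_mul, ← prodP, hodd.eq, hlead.eq, hc.eq]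

variable {tw tv : List ℤ} {𝒳 𝒴 : List (Matrix (Fin n) (Fin n) ℂ)}

theorem congruenceFactor_mul_colKron {r : ℕ} (htw : IsCanonical h tw)
    (htv : IsCanonical (m - h - 1) (shift m tv)) (h𝒳 : 𝒳.length = tw.length)
    (h𝒴 : 𝒴.length = tv.length) (C : Matrix (Fin n) (Fin r) ℂ) :
    congruenceFactor m h a tw tv 𝒳 𝒴 * colKron m m C =
      colKron m (m - inversionsAt 0 (tw ++ simpleTuple h)) C := by
  obtain ⟨s, -, _, hav₁, htrack₁, hav₂, htrack₂, hle⟩ := exists_track_altTuple hh htw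
  set p₀ : Fin m := Fin.rev ⟨0, by omega⟩ with hp₀
  have hlast : (p₀.rev : ℕ) = 0 := by rw [hp₀, Fin.rev_rev]
  obtain ⟨p₁, hp₁, hmul₁⟩ := prodM_mul_blockCol p₀ (t := altTuple (h - 1))
    (fun i hi => by rw [mem_altTuple] at hi; omega) (by rwa [hlast, Nat.cast_zero])
    (List.length_map fun i : ℤ => if 0 ≤ i then -a i.natAbs else a i.natAbs) C
  rw [hlast, Nat.cast_zero, htrack₁] at hp₁
  obtain ⟨p₂, hp₂, hmul₂⟩ := prodM_mul_blockCol p₁ (t := tw)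
    (fun i hi => by have := htw.mem_bounds hi; omega) (by rwa [hp₁]) h𝒳 C
  rw [hp₁, htrack₂] at hp₂
  rw [congruenceFactor, Matrix.mul_assoc, outerFactor_mul_colKron a hm,
    colKron_self_eq_blockCol hlast, prodP_eq_prodM, hmul₁, prodM_append h𝒴, Matrix.mul_assoc,
    hmul₂, ← hp₂, colKron_eq_blockCol]
  refine prodM_mul_blockCol_of_notMem tv (fun i hi h => ?_) 𝒴 C
  have htvi := htv.mem_bounds (mem_shift.2 (by rwa [add_sub_cancel_right]) : i + m ∈ shift m tv)
  simp only [levelSupport, Set.mem_ofPred_eq] at h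
  omega

theorem complement_mul_prodM (h𝒳 : 𝒳.length = tw.length) (h𝒴 : 𝒴.length = tv.length)
    (ha : ∀ j ≤ m, (a j).IsSymm) (h𝒳s : ∀ M ∈ 𝒳, M.IsSymm) (h𝒴s : ∀ M ∈ 𝒴, M.IsSymm) :
    prodP m a (simpleComplement h ++ shift (-m) (simpleComplement (m - h - 1))) *
        prodM m (tw.reverse ++ tv.reverse) (𝒳.reverse ++ 𝒴.reverse) =
      prodP m a (leadTuple m) * (congruenceFactor m h a tw tv 𝒳 𝒴)ᵀ := by
  have hsymm : ∀ M ∈ 𝒴 ++ 𝒳, M.IsSymm := List.forall_mem_append.2 ⟨h𝒴s, h𝒳s⟩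
  rw [prodP_complement a hm hh, congruenceFactor, transpose_mul, (outerFactor_isSymm a hm ha).eq,
    prodM_transpose (by simp [h𝒳, h𝒴]) hsymm, List.reverse_append, List.reverse_append, mul_assoc]

theorem pencilP_eq (h𝒳 : 𝒳.length = tw.length) (h𝒴 : 𝒴.length = tv.length)
    (ha : ∀ j ≤ m, (a j).IsSymm) (h𝒳s : ∀ M ∈ 𝒳, M.IsSymm) (h𝒴s : ∀ M ∈ 𝒴, M.IsSymm) :
    pencilP m h a tw tv 𝒳 𝒴 = cPoly (congruenceFactor m h a tw tv 𝒳 𝒴) *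
      ((Polynomial.X : ℂ[X]) • cPoly (fiedlerP m a (-m) * prodP m a (oddTuple m h)) -
        cPoly (prodP m a (evenTuple m h))) *
      cPoly (prodP m a (leadTuple m) * (congruenceFactor m h a tw tv 𝒳 𝒴)ᵀ) := by
  rw [pencilP, Matrix.mul_assoc _ (cPoly _) (cPoly _), ← cPoly_mul (prodP m a (_ ++ _)),
    complement_mul_prodM a hm hh h𝒳 h𝒴 ha h𝒳s h𝒴s, prodP_shift_simpleTuple a hh hm,
    prodP_simpleTuple a hh hm, cPoly_mul (outerFactor m a h), cPoly_mul (outerFactor m a h),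
    ← Matrix.mul_smul, ← Matrix.mul_sub, ← Matrix.mul_assoc (cPoly _) (cPoly (outerFactor m a h)),
    ← cPoly_mul, ← congruenceFactor]

theorem pencilP_isSymm (h𝒳 : 𝒳.length = tw.length) (h𝒴 : 𝒴.length = tv.length)
    (ha : ∀ j ≤ m, (a j).IsSymm) (h𝒳s : ∀ M ∈ 𝒳, M.IsSymm) (h𝒴s : ∀ M ∈ 𝒴, M.IsSymm) :
    (pencilP m h a tw tv 𝒳 𝒴).IsSymm := by
  have hcore : ((Polynomial.X : ℂ[X]) •
      cPoly (fiedlerP m a (-m) * prodP m a (oddTuple m h) * prodP m a (leadTuple m)) -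
        cPoly (prodP m a (evenTuple m h) * prodP m a (leadTuple m))).IsSymm :=
    (((prodP_oddTuple_mul_leadTuple_isSymm a hm hh ha).map _).smul _).sub
      ((prodP_evenTuple_mul_leadTuple_isSymm a hm hh ha).map _)
  rw [pencilP_eq a hm hh h𝒳 h𝒴 ha h𝒳s h𝒴s, cPoly_mul (prodP m a (leadTuple m)),
    ← Matrix.mul_assoc, Matrix.mul_assoc (cPoly (congruenceFactor m h a tw tv 𝒳 𝒴)), Matrix.sub_mul,
    Matrix.smul_mul, ← cPoly_mul, ← cPoly_mul, ← cPoly_transpose,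
    IsSymm, transpose_mul, transpose_mul, transpose_transpose, hcore.eq, ← Matrix.mul_assoc]

theorem rowKron_mul_leadTuple_mul {r : ℕ} (htw : IsCanonical h tw)
    (htv : IsCanonical (m - h - 1) (shift m tv)) (h𝒳 : 𝒳.length = tw.length)
    (h𝒴 : 𝒴.length = tv.length) (ha : ∀ j ≤ m, (a j).IsSymm) (B : Matrix (Fin r) (Fin n) ℂ) :
    rowKron m m B * (prodP m a (leadTuple m) * (congruenceFactor m h a tw tv 𝒳 𝒴)ᵀ) =
      rowKron m (m - inversionsAt 0 (tw ++ simpleTuple h)) B := by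
  have hlead : (prodP m a (leadTuple m)).IsSymm :=
    prodP_isSymm a ha (by grind [leadTuple]) (by unfold leadTuple; split_ifs <;> simp)
  rw [← transpose_inj, transpose_mul, transpose_mul, transpose_transpose, rowKron_transpose,
    rowKron_transpose, hlead.eq, Matrix.mul_assoc, prodP_mul_colKron_self a (by omega)
    (by grind [leadTuple]), congruenceFactor_mul_colKron a hm hh htw htv h𝒳 h𝒴]

theorem pencilS_eq_systemMatrix {r : ℕ} (htw : IsCanonical h tw)
    (htv : IsCanonical (m - h - 1) (shift m tv)) (h𝒳 : 𝒳.length = tw.length)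
    (h𝒴 : 𝒴.length = tv.length) (ha : ∀ j ≤ m, (a j).IsSymm) (h𝒳s : ∀ M ∈ 𝒳, M.IsSymm)
    (h𝒴s : ∀ M ∈ 𝒴, M.IsSymm) (A E : Matrix (Fin r) (Fin r) ℂ) (B : Matrix (Fin r) (Fin n) ℂ)
    (C : Matrix (Fin n) (Fin r) ℂ) : pencilS m h a A B C E tw tv 𝒳 𝒴 =
      systemMatrix (pencilP m h a tw tv 𝒳 𝒴) A
        (rowKron m (m - inversionsAt 0 (tw ++ simpleTuple h)) B)
        (colKron m (m - inversionsAt 0 (tw ++ simpleTuple h)) C) E := by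
  have hC : prodM m (tv ++ tw) (𝒴 ++ 𝒳) * (prodP m a (altTuple (h - 1)) *
      prodP m a (altTuple h) * colKron m m C) =
        colKron m (m - inversionsAt 0 (tw ++ simpleTuple h)) C := by
    rw [← congruenceFactor_mul_colKron a hm hh htw htv h𝒳 h𝒴, congruenceFactor,
      Matrix.mul_assoc _ (outerFactor m a h), outerFactor_mul_colKron a hm,
      Matrix.mul_assoc (prodP m a _), prodP_mul_colKron_self a (by omega) fun i hi => by
        rw [mem_altTuple] at hi; grind]
  have hB := rowKron_mul_leadTuple_mul a hm hh htw htv h𝒳 h𝒴 ha B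
  rw [← complement_mul_prodM a hm hh h𝒳 h𝒴 ha h𝒳s h𝒴s] at hB
  obtain ⟨q, rfl⟩ := even_iff_exists_two_mul.1 hh
  rw [← hB, ← hC, pencilS, pencilP, systemMatrix, prodSS_simpleTuple a A B C E hm,
    prodSS_shift_simpleTuple a A B C E (by omega), prodMM_eq, prodMM_eq, prodPP_eq, extendOne,
    extendOne, extendOne]
  simp [cPoly_fromBlocks, cPoly_mul, cPoly_neg, cPoly_zero, cPoly_one, fromBlocks_smul,
    sub_eq_add_neg, fromBlocks_neg, fromBlocks_add, fromBlocks_multiply, Matrix.mul_assoc, add_comm]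

end PencilFactorization

section Nonsingularity
variable {m n h : ℕ} (a : ℕ → Matrix (Fin n) (Fin n) ℂ)

theorem det_prodP_leadTuple_ne_zero (hm : 0 < m) (ham : Even m → (a m).det ≠ 0) :
    (prodP m a (leadTuple m)).det ≠ 0 := by
  unfold leadTuple
  split_ifs with heven
  · refine det_prodP_ne_zero m a fun i hi => ?_
    obtain rfl := List.mem_singleton.1 hi
    exact ⟨neg_ne_zero.2 (Nat.cast_ne_zero.2 hm.ne'), fun _ => ham heven⟩
  · simp [prodP]

theorem det_congruenceFactor_ne_zero {tw tv : List ℤ}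
    {𝒳 𝒴 : List (Matrix (Fin n) (Fin n) ℂ)} (h𝒳 : IsNonsingularAssignment m tw 𝒳)
    (h𝒴 : IsNonsingularAssignment m tv 𝒴) : (congruenceFactor m h a tw tv 𝒳 𝒴).det ≠ 0 := by
  rw [congruenceFactor, prodM_append h𝒴.1, outerFactor, det_mul, det_mul, det_mul]
  refine mul_ne_zero (mul_ne_zero (det_prodM_ne_zero h𝒴) (det_prodM_ne_zero h𝒳))
    (mul_ne_zero (det_prodP_ne_zero m a fun i hi => ?_) (det_prodP_ne_zero m a fun i hi => ?_))
  · rw [mem_altTuple] at hi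
    omega
  · rw [mem_shift, mem_altTuple] at hi
    omega

end Nonsingularity

section Limits
variable {𝕜 : Type*} [NontriviallyNormedField 𝕜] {f g : RatFunc 𝕜} {c d : 𝕜}

/-- The rational function `f` is proper, with value `c` at infinity. -/
def HasLim (f : RatFunc 𝕜) (c : 𝕜) : Prop :=
  Tendsto (fun z => RatFunc.eval (RingHom.id 𝕜) z f) (Bornology.cobounded 𝕜) (𝓝 c)

theorem eventually_denom_ne_zero (f : RatFunc 𝕜) :
    ∀ᶠ z in Bornology.cobounded 𝕜, f.denom.eval₂ (RingHom.id 𝕜) z ≠ 0 := by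
  filter_upwards [Bornology.isBounded_def.1
    (Polynomial.finite_setOfPred_isRoot f.denom_ne_zero).isBounded] with z hz h
  exact hz (by simpa [Polynomial.IsRoot, Polynomial.eval₂_id] using h)

namespace HasLim

theorem add (hf : HasLim f c) (hg : HasLim g d) : HasLim (f + g) (c + d) := by
  refine (Tendsto.add hf hg).congr' ?_
  filter_upwards [eventually_denom_ne_zero f, eventually_denom_ne_zero g] with z hzf hzg
  exact (RatFunc.eval_add _ _ hzf hzg).symm

theorem mul (hf : HasLim f c) (hg : HasLim g d) : HasLim (f * g) (c * d) := by
  refine (Tendsto.mul hf hg).congr' ?_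
  filter_upwards [eventually_denom_ne_zero f, eventually_denom_ne_zero g] with z hzf hzg
  exact (RatFunc.eval_mul _ _ hzf hzg).symm

theorem C (c : 𝕜) : HasLim (RatFunc.C c) c := by
  simp [HasLim]

theorem zero : HasLim (0 : RatFunc 𝕜) 0 := by
  simpa using C (0 : 𝕜)

theorem one : HasLim (1 : RatFunc 𝕜) 1 := by
  simpa using C (1 : 𝕜)

theorem neg (hf : HasLim f c) : HasLim (-f) (-c) := by
  simpa using (C (-1)).mul hf

theorem ne_zero (hf : HasLim f c) (hc : c ≠ 0) : f ≠ 0 := by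
  rintro rfl
  exact hc (tendsto_nhds_unique hf zero)

end HasLim

theorem eventually_eval_inv (hf : f ≠ 0) : ∀ᶠ z in Bornology.cobounded 𝕜,
    RatFunc.eval (RingHom.id 𝕜) z f⁻¹ = (RatFunc.eval (RingHom.id 𝕜) z f)⁻¹ := by
  filter_upwards [eventually_denom_ne_zero f, eventually_denom_ne_zero f⁻¹] with z hz hz'
  refine eq_inv_of_mul_eq_one_left ?_
  rw [← RatFunc.eval_mul _ _ hz' hz, inv_mul_cancel₀ hf, RatFunc.eval_one]

namespace HasLim

theorem inv (hf : HasLim f c) (hc : c ≠ 0) : HasLim f⁻¹ c⁻¹ := by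
  refine (Tendsto.inv₀ hf hc).congr' ?_
  filter_upwards [eventually_eval_inv (hf.ne_zero hc)] with z hz using hz.symm

theorem X_inv : HasLim (RatFunc.X : RatFunc 𝕜)⁻¹ 0 := by
  refine tendsto_inv₀_cobounded.congr' ?_
  filter_upwards [eventually_eval_inv (RatFunc.X_ne_zero (K := 𝕜))] with z hz
  rw [hz, RatFunc.eval_X]

variable {ι : Type*} {f : ι → RatFunc 𝕜} {c : ι → 𝕜}

theorem sum (s : Finset ι) (h : ∀ i ∈ s, HasLim (f i) (c i)) :
    HasLim (∑ i ∈ s, f i) (∑ i ∈ s, c i) := by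
  classical
  induction s using Finset.induction_on with
  | empty => simpa using zero
  | insert i s hi ih =>
    rw [Finset.sum_insert hi, Finset.sum_insert hi]
    rw [Finset.forall_mem_insert] at h
    exact h.1.add (ih h.2)

theorem prod (s : Finset ι) (h : ∀ i ∈ s, HasLim (f i) (c i)) :
    HasLim (∏ i ∈ s, f i) (∏ i ∈ s, c i) := by
  classical
  induction s using Finset.induction_on with
  | empty => simpa using one
  | insert i s hi ih =>
    rw [Finset.prod_insert hi, Finset.prod_insert hi]
    rw [Finset.forall_mem_insert] at h
    exact h.1.mul (ih h.2)

theorem pow {f : RatFunc 𝕜} {c : 𝕜} (hf : HasLim f c) (k : ℕ) : HasLim (f ^ k) (c ^ k) := by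
  simpa using prod (Finset.range k) fun _ _ => hf

end HasLim

/-- The rational matrix `F` is proper, with value `D` at infinity. -/
def MatLim {ι κ : Type*} (F : Matrix ι κ (RatFunc 𝕜)) (D : Matrix ι κ 𝕜) : Prop :=
  ∀ i j, HasLim (F i j) (D i j)

namespace MatLim
variable {ι κ ν : Type*} {F G : Matrix ι κ (RatFunc 𝕜)} {D K : Matrix ι κ 𝕜}

theorem add (hF : MatLim F D) (hG : MatLim G K) : MatLim (F + G) (D + K) :=
  fun i j => (hF i j).add (hG i j)

theorem neg (hF : MatLim F D) : MatLim (-F) (-D) := fun i j => (hF i j).neg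

theorem smul {f : RatFunc 𝕜} {c : 𝕜} (hf : HasLim f c) (hF : MatLim F D) :
    MatLim (f • F) (c • D) := fun i j => hf.mul (hF i j)

theorem mul [Fintype κ] {G : Matrix κ ν (RatFunc 𝕜)} {K : Matrix κ ν 𝕜} (hF : MatLim F D)
    (hG : MatLim G K) : MatLim (F * G) (D * K) :=
  fun i j => HasLim.sum _ fun k _ => (hF i k).mul (hG k j)

theorem submatrix {ι' κ' : Type*} (hF : MatLim F D) (e : ι' → ι) (e' : κ' → κ) :
    MatLim (F.submatrix e e') (D.submatrix e e') := fun i j => hF (e i) (e' j)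

theorem zero : MatLim (0 : Matrix ι κ (RatFunc 𝕜)) 0 := fun _ _ => HasLim.zero

theorem one [DecidableEq ι] : MatLim (1 : Matrix ι ι (RatFunc 𝕜)) 1 := fun i j => by
  rw [one_apply, one_apply]
  split_ifs
  exacts [HasLim.one, HasLim.zero]

theorem updateCol [DecidableEq κ] (hF : MatLim F D) (j₀ : κ) {f : ι → RatFunc 𝕜} {c : ι → 𝕜}
    (hf : ∀ i, HasLim (f i) (c i)) : MatLim (F.updateCol j₀ f) (D.updateCol j₀ c) := fun i j => by
  rw [updateCol_apply, updateCol_apply]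
  split_ifs
  exacts [hf i, hF i j]

variable [Fintype ι] [DecidableEq ι] {F : Matrix ι ι (RatFunc 𝕜)} {D : Matrix ι ι 𝕜}

theorem det (hF : MatLim F D) : HasLim F.det D.det := by
  rw [det_apply', det_apply']
  refine HasLim.sum _ fun σ _ => HasLim.mul ?_ (HasLim.prod _ fun i _ => hF _ _)
  simpa using HasLim.C ((Equiv.Perm.sign σ : ℤ) : 𝕜)

theorem isUnit_det (hF : MatLim F D) (hD : D.det ≠ 0) : IsUnit F.det :=
  isUnit_iff_ne_zero.2 (hF.det.ne_zero hD)

theorem inv (hF : MatLim F D) (hD : D.det ≠ 0) : MatLim F⁻¹ D⁻¹ := by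
  rw [inv_def, inv_def, Ring.inverse_eq_inv', Ring.inverse_eq_inv']
  refine MatLim.smul (hF.det.inv hD) fun i j => ?_
  rw [adjugate_apply, adjugate_apply]
  refine MatLim.det fun k l => ?_
  rw [updateRow_apply, updateRow_apply, Pi.single_apply, Pi.single_apply]
  split_ifs
  exacts [HasLim.one, HasLim.zero, hF k l]

end MatLim

end Limits

section Biproper
variable {ι : Type} [Fintype ι] [DecidableEq ι] {F G : Matrix ι ι (RatFunc ℂ)}

theorem isBiproper_iff : IsBiproper F ↔ ∃ D : Matrix ι ι ℂ, D.det ≠ 0 ∧ MatLim F D :=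
  exists_congr fun _ => and_congr_right fun _ =>
    tendsto_pi_nhds.trans <| forall_congr' fun _ => tendsto_pi_nhds

namespace IsBiproper

theorem mul (hF : IsBiproper F) (hG : IsBiproper G) : IsBiproper (F * G) := by
  rw [isBiproper_iff] at hF hG ⊢
  obtain ⟨D, hD, hFD⟩ := hF
  obtain ⟨K, hK, hGK⟩ := hG
  exact ⟨D * K, by rw [det_mul]; exact mul_ne_zero hD hK, hFD.mul hGK⟩

theorem inv (hF : IsBiproper F) : IsBiproper F⁻¹ := by
  rw [isBiproper_iff] at hF ⊢
  obtain ⟨D, hD, hFD⟩ := hF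
  exact ⟨D⁻¹, by simpa [det_nonsing_inv] using hD, hFD.inv hD⟩

theorem isUnit_det (hF : IsBiproper F) : IsUnit F.det := by
  obtain ⟨D, hD, hFD⟩ := isBiproper_iff.1 hF
  exact hFD.isUnit_det hD

theorem submatrix (hF : IsBiproper F) (σ τ : Equiv.Perm ι) : IsBiproper (F.submatrix σ τ) := by
  rw [isBiproper_iff] at hF ⊢
  obtain ⟨D, hD, hFD⟩ := hF
  refine ⟨D.submatrix σ τ, ?_, hFD.submatrix σ τ⟩
  rw [show D.submatrix σ τ = (D.submatrix σ id).submatrix id τ from rfl, det_permute', det_permute]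
  simpa using hD

theorem cRat {D : Matrix ι ι ℂ} (hD : D.det ≠ 0) : IsBiproper (cRat D) :=
  isBiproper_iff.2 ⟨D, hD, fun _ _ => HasLim.C _⟩

end IsBiproper

end Biproper

section RationalMatrices
variable {ι κ : Type}

theorem cRat_mul {ν : Type} [Fintype κ] (M : Matrix ι κ ℂ) (N : Matrix κ ν ℂ) :
    cRat (M * N) = cRat M * cRat N :=
  Matrix.map_mul

theorem polyToRat_mul {ν : Type} [Fintype κ] (M : Matrix ι κ ℂ[X]) (N : Matrix κ ν ℂ[X]) :
    polyToRat (M * N) = polyToRat M * polyToRat N :=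
  Matrix.map_mul

theorem polyToRat_add (M N : Matrix ι κ ℂ[X]) :
    polyToRat (M + N) = polyToRat M + polyToRat N :=
  Matrix.map_add _ (map_add _) M N

theorem polyToRat_sub (M N : Matrix ι κ ℂ[X]) :
    polyToRat (M - N) = polyToRat M - polyToRat N :=
  Matrix.map_sub _ (map_sub _) M N

theorem polyToRat_sum {σ : Type*} (s : Finset σ) (F : σ → Matrix ι κ ℂ[X]) :
    polyToRat (∑ k ∈ s, F k) = ∑ k ∈ s, polyToRat (F k) := by
  ext i j
  simp [polyToRat, Matrix.sum_apply]

theorem polyToRat_cPoly (M : Matrix ι κ ℂ) : polyToRat (cPoly M) = cRat M := by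
  ext i j
  simp [polyToRat, cPoly, cRat, RatFunc.algebraMap_C]

theorem polyToRat_X_pow_smul (k : ℕ) (M : Matrix ι κ ℂ[X]) :
    polyToRat ((X : ℂ[X]) ^ k • M) = (RatFunc.X : RatFunc ℂ) ^ k • polyToRat M := by
  ext i j
  simp [polyToRat, RatFunc.algebraMap_X]

theorem polyToRat_injective : Function.Injective (polyToRat (ι := ι) (κ := κ)) :=
  Matrix.map_injective (RatFunc.algebraMap_injective ℂ)

theorem matLim_cRat (M : Matrix ι κ ℂ) : MatLim (cRat M) M :=
  fun _ _ => HasLim.C _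

end RationalMatrices

section Realizations
variable {r : ℕ}

section StrictlyProper
variable {ι κ : Type} {A E : Matrix (Fin r) (Fin r) ℂ}

/-- The strictly proper part `C (λ E - A)⁻¹ B` of a transfer function. -/
noncomputable def properPart (A : Matrix (Fin r) (Fin r) ℂ) (B : Matrix (Fin r) κ ℂ)
    (C : Matrix ι (Fin r) ℂ) (E : Matrix (Fin r) (Fin r) ℂ) : Matrix ι κ (RatFunc ℂ) :=
  cRat C * ((RatFunc.X : RatFunc ℂ) • cRat E - cRat A)⁻¹ * cRat B

theorem transferFunction_eq (P : Matrix ι ι ℂ[X]) (A : Matrix (Fin r) (Fin r) ℂ)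
    (B : Matrix (Fin r) ι ℂ) (C : Matrix ι (Fin r) ℂ) (E : Matrix (Fin r) (Fin r) ℂ) :
    transferFunction P A B C E = polyToRat P + properPart A B C E := rfl

theorem matLim_resolvent (A : Matrix (Fin r) (Fin r) ℂ) (hE : E.det ≠ 0) :
    MatLim ((RatFunc.X : RatFunc ℂ) • cRat E - cRat A)⁻¹ 0 := by
  have hX : (RatFunc.X : RatFunc ℂ) ≠ 0 := RatFunc.X_ne_zero
  have hlim : MatLim (cRat E - (RatFunc.X : RatFunc ℂ)⁻¹ • cRat A) E := by
    simpa [sub_eq_add_neg] using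
      (matLim_cRat E).add (MatLim.smul HasLim.X_inv (matLim_cRat A)).neg
  have hinv : ((RatFunc.X : RatFunc ℂ) • cRat E - cRat A)⁻¹ =
      (RatFunc.X : RatFunc ℂ)⁻¹ • (cRat E - (RatFunc.X : RatFunc ℂ)⁻¹ • cRat A)⁻¹ := by
    refine Matrix.inv_eq_right_inv ?_
    rw [Matrix.mul_smul, ← Matrix.smul_mul, smul_sub, inv_smul_smul₀ hX,
      Matrix.mul_nonsing_inv _ (hlim.isUnit_det hE)]
  rw [hinv]
  simpa using MatLim.smul HasLim.X_inv (hlim.inv hE)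

theorem matLim_properPart (A : Matrix (Fin r) (Fin r) ℂ) (B : Matrix (Fin r) κ ℂ)
    (C : Matrix ι (Fin r) ℂ) (hE : E.det ≠ 0) : MatLim (properPart A B C E) 0 := by
  simpa [properPart] using ((matLim_cRat C).mul (matLim_resolvent A hE)).mul (matLim_cRat B)

variable (hA : A.IsSymm) (hE : E.IsSymm)
include hA hE

theorem properPart_isSymm (B : Matrix (Fin r) ι ℂ) : (properPart A B Bᵀ E).IsSymm := by
  have hpencil : ((RatFunc.X : RatFunc ℂ) • cRat E - cRat A).IsSymm :=
    ((hE.map _).smul _).sub (hA.map _)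
  rw [IsSymm, properPart, transpose_mul, transpose_mul, transpose_nonsing_inv, hpencil.eq,
    Matrix.mul_assoc]
  rfl

variable {P : Matrix ι ι ℂ[X]}

theorem transferFunction_isSymm (hP : P.IsSymm) (B : Matrix (Fin r) ι ℂ) :
    (transferFunction P A B Bᵀ E).IsSymm :=
  (hP.map _).add (properPart_isSymm hA hE B)

theorem systemMatrix_isSymm (hP : P.IsSymm) (B : Matrix (Fin r) ι ℂ) :
    (systemMatrix P A B Bᵀ E).IsSymm :=
  hP.fromBlocks rfl ((hA.map _).sub ((hE.map _).smul _))

theorem isSymm_of_transferFunction (B : Matrix (Fin r) ι ℂ)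
    (h : (transferFunction P A B Bᵀ E).IsSymm) : P.IsSymm := by
  refine polyToRat_injective (add_right_cancel (b := properPart A B Bᵀ E) ?_)
  calc polyToRat Pᵀ + properPart A B Bᵀ E
      = polyToRat Pᵀ + (properPart A B Bᵀ E)ᵀ := by rw [properPart_isSymm hA hE B]
    _ = polyToRat P + properPart A B Bᵀ E := h

end StrictlyProper

variable {m n : ℕ}

theorem coeff_matPoly (a : ℕ → Matrix (Fin n) (Fin n) ℂ) {j : ℕ} (hj : j ≤ m) (c d : Fin n) :
    (matPoly m a c d).coeff j = a j c d := by
  simp [matPoly, Matrix.sum_apply, cPoly, Polynomial.finsetSum_coeff, Polynomial.coeff_X_pow,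
    Nat.lt_succ_of_le hj]

theorem isSymm_of_matPoly {a : ℕ → Matrix (Fin n) (Fin n) ℂ} (h : (matPoly m a).IsSymm) {j : ℕ}
    (hj : j ≤ m) : (a j).IsSymm := by
  ext c d
  rw [transpose_apply, ← coeff_matPoly a hj, ← coeff_matPoly a hj, h.apply]

theorem isMinimalRealization_of_block {G : Matrix (Fin n) (Fin n) (RatFunc ℂ)}
    {P : Matrix (Fin n) (Fin n) ℂ[X]} {A E : Matrix (Fin r) (Fin r) ℂ}
    {B : Matrix (Fin r) (Fin n) ℂ} {C : Matrix (Fin n) (Fin r) ℂ}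
    (h : IsMinimalRealization G P A B C E) (L : Matrix (Fin m × Fin n) (Fin m × Fin n) ℂ[X])
    (p : Fin m) :
    IsMinimalRealization (transferFunction L A (blockRow p B) (blockCol p C) E) L A
      (blockRow p B) (blockCol p C) E := by
  refine ⟨⟨h.1.1, rfl⟩, fun r' P' A' B' C' E' ⟨hE', hG'⟩ => ?_⟩
  let e : Fin n → Fin m × Fin n := fun c => (p, c)
  have hB : (blockRow p B).submatrix id e = B := by ext; simp [blockRow, e]
  have hC : (blockCol p C).submatrix e id = C := by ext; simp [blockCol, e]
  have hblock : polyToRat (L.submatrix e e) + properPart A ((blockRow p B).submatrix id e)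
      ((blockCol p C).submatrix e id) E = polyToRat (P'.submatrix e e) +
        properPart A' (B'.submatrix id e) (C'.submatrix e id) E' :=
    congrArg (fun M => M.submatrix e e) hG'
  rw [hB, hC] at hblock
  refine h.2 r' (P'.submatrix e e - L.submatrix e e + P) A' (B'.submatrix id e) (C'.submatrix e id)
    E' ⟨hE', ?_⟩
  rw [h.1.2, transferFunction_eq, transferFunction_eq, polyToRat_add, polyToRat_sub,
    eq_sub_of_add_eq' hblock]
  abel

end Realizations

section Pencil
variable {m n : ℕ} {R S : Type*} [CommRing R] [CommRing S]

theorem smul_map_theta_sub (φ : R →+* S) (s t : S) (a : ℕ → Matrix (Fin n) (Fin n) R) :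
    s • (compRingEquiv (Fin m) (Fin n) R (ofLevels m (theta m (1 : R) 0 a))).map φ
      - t • (compRingEquiv (Fin m) (Fin n) R (ofLevels m (theta m (0 : R) (-1) a))).map φ =
    compRingEquiv (Fin m) (Fin n) S (ofLevels m (theta m s t fun j => (a j).map φ)) := by
  ext ⟨p, c⟩ ⟨q, d⟩
  change s • φ (theta m (1 : R) 0 a p.rev q.rev c d)
    - t • φ (theta m (0 : R) (-1) a p.rev q.rev c d) =
      theta m s t (fun j => (a j).map φ) p.rev q.rev c d
  unfold theta
  split_ifs <;> simp [one_apply] <;> split_ifs <;> simp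

theorem comp_theta_update_zero {p₀ : Fin m} (hp₀ : (p₀.rev : ℕ) = 0) (s t : R)
    (a : ℕ → Matrix (Fin n) (Fin n) R) (Z : Matrix (Fin n) (Fin n) R) :
    compRingEquiv (Fin m) (Fin n) R
        (ofLevels m (theta m s t (Function.update a 0 (a 0 + Z)))) =
      compRingEquiv (Fin m) (Fin n) R (ofLevels m (theta m s t a))
        + t • blockCol p₀ (blockRow p₀ Z) := by
  ext ⟨p, c⟩ ⟨q, d⟩
  have hm : m ≠ 0 := (Fin.pos p).ne'
  have hlevel : ∀ p : Fin m, p = p₀ ↔ (p.rev : ℕ) = 0 := fun p => by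
    rw [← hp₀, ← Fin.ext_iff, Fin.rev_inj]
  change theta m s t (Function.update a 0 (a 0 + Z)) p.rev q.rev c d =
    theta m s t a p.rev q.rev c d + t • (if p = p₀ then if q = p₀ then Z c d else 0 else 0)
  simp only [hlevel]
  generalize (p.rev : ℕ) = k
  generalize (q.rev : ℕ) = l
  unfold theta
  rcases eq_or_ne k l with rfl | hkl
  · rcases eq_or_ne k 0 with rfl | hk
    · simp [add_assoc]
    · simp [hk]
  · have _ : ¬ (k = 0 ∧ l = 0) := fun h => hkl (h.1.trans h.2.symm)
    split_ifs <;> simp_all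

theorem updateCol_theta_of_odd (hm : Odd m) {p₁ : Fin m} (hp₁ : (p₁.rev : ℕ) + 1 = m)
    {M : Type*} [Ring M] [Algebra R M] (a : ℕ → M) :
    updateCol (ofLevels m (theta m (1 : R) 0 a)) p₁ (Pi.single p₁ 1) =
      ofLevels m (theta m (1 : R) 0 (Function.update a m 1)) := by
  have hlevel : ∀ p : Fin m, p = p₁ ↔ (p.rev : ℕ) + 1 = m := fun p => by
    rw [← Fin.rev_inj, Fin.ext_iff]
    omega
  rw [Nat.odd_iff] at hm
  ext1 p q
  have hp := p.rev.2
  have hq := q.rev.2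
  simp only [updateCol_apply, Pi.single_apply, hlevel, ofLevels, of_apply]
  generalize (p.rev : ℕ) = k at hp ⊢
  generalize (q.rev : ℕ) = l at hq ⊢
  unfold theta
  split_ifs <;> first | omega | (simp [Function.update_apply] <;> omega)

end Pencil

section StructureAtInfinity
variable {m n : ℕ} {a : ℕ → Matrix (Fin n) (Fin n) ℂ}
  {F : ℕ → Matrix (Fin n) (Fin n) (RatFunc ℂ)} {t : RatFunc ℂ}

theorem matLim_comp {Y : Matrix (Fin m) (Fin m) (Matrix (Fin n) (Fin n) (RatFunc ℂ))}
    {D : Matrix (Fin m) (Fin m) (Matrix (Fin n) (Fin n) ℂ)} (h : ∀ p q, MatLim (Y p q) (D p q)) :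
    MatLim (compRingEquiv (Fin m) (Fin n) (RatFunc ℂ) Y) (compRingEquiv (Fin m) (Fin n) ℂ D) :=
  fun p q => h p.1 q.1 p.2 q.2

theorem matLim_comp_updateCol {Y : Matrix (Fin m) (Fin m) (Matrix (Fin n) (Fin n) (RatFunc ℂ))}
    {D : Matrix (Fin m) (Fin m) (Matrix (Fin n) (Fin n) ℂ)} (h : ∀ p q, MatLim (Y p q) (D p q))
    (p₁ : Fin m) {f : Fin m → Matrix (Fin n) (Fin n) (RatFunc ℂ)}
    {c : Fin m → Matrix (Fin n) (Fin n) ℂ} (hf : ∀ p, MatLim (f p) (c p)) :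
    MatLim (compRingEquiv (Fin m) (Fin n) (RatFunc ℂ) (updateCol Y p₁ f))
      (compRingEquiv (Fin m) (Fin n) ℂ (updateCol D p₁ c)) :=
  matLim_comp fun p q => by
    rw [updateCol_apply, updateCol_apply]
    split_ifs
    exacts [hf p, h p q]

theorem matLim_ite (P : Prop) [Decidable P] : MatLim (if P then 1 else 0)
    (if P then 1 else 0 : Matrix (Fin n) (Fin n) ℂ) := by
  split_ifs
  exacts [MatLim.one, MatLim.zero]

theorem det_comp_theta_ne_zero (hm : 0 < m) (ham : (a m).det ≠ 0) :
    (compRingEquiv (Fin m) (Fin n) ℂ (ofLevels m (theta m (1 : ℂ) 0 a))).det ≠ 0 := by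
  rw [← fiedlerP_mul_prodP_oddTuple a (h := 0) (by simp) hm, ← prodP_singleton, ← prodP_append]
  refine det_prodP_ne_zero m a fun i hi => ?_
  rw [List.mem_append, List.mem_singleton, mem_oddTuple (by simp) hm] at hi
  exact ⟨by omega, fun _ => ham⟩

theorem det_updateCol_theta_of_odd_ne_zero (hm : Odd m) {p₁ : Fin m} (hp₁ : (p₁.rev : ℕ) + 1 = m) :
    (compRingEquiv (Fin m) (Fin n) ℂ
      (updateCol (ofLevels m (theta m (1 : ℂ) 0 a)) p₁ (Pi.single p₁ 1))).det ≠ 0 := by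
  rw [updateCol_theta_of_odd hm hp₁]
  exact det_comp_theta_ne_zero hm.pos (by simp)

variable (hF : ∀ j, MatLim (F j) (a j)) (ht : HasLim t 0)
include hF ht

theorem matLim_theta (k l : ℕ) : MatLim (theta m 1 t F k l) (theta m (1 : ℂ) 0 a k l) := by
  have hneg : MatLim (-t • (1 : Matrix (Fin n) (Fin n) (RatFunc ℂ))) (-(0 : ℂ) • 1) :=
    MatLim.smul ht.neg MatLim.one
  have hone : MatLim ((1 : RatFunc ℂ) • (1 : Matrix (Fin n) (Fin n) (RatFunc ℂ))) ((1 : ℂ) • 1) :=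
    MatLim.smul HasLim.one MatLim.one
  unfold theta
  split_ifs
  exacts [(MatLim.smul HasLim.one (hF _)).add (MatLim.smul ht (hF _)), hneg, MatLim.zero, hneg,
    MatLim.smul HasLim.one (hF _), hone, hneg, hone, MatLim.zero]

theorem matLim_hornerDown (k : ℕ) : MatLim (hornerDown t F k) (a k) := by
  induction k with
  | zero => simpa only [hornerDown_zero] using hF 0
  | succ k ih => simpa only [hornerDown_succ, zero_smul, add_zero] using
      (hF (k + 1)).add (MatLim.smul ht ih)

theorem matLim_colDown {q k : ℕ} (hk : k < 2 * q + 1) :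
    MatLim (colDown t F q k) (if k = 2 * q then 1 else 0) := by
  obtain ⟨j, rfl | rfl⟩ := k.even_or_odd'
  · rw [colDown_two_mul]
    convert MatLim.smul (ht.pow (q - j)) MatLim.one using 1
    split_ifs with h
    · simp [show q - j = 0 by omega]
    · simp [show q - j ≠ 0 by omega]
  · rw [colDown_two_mul_add_one, if_neg (by omega)]
    have := (MatLim.smul (ht.pow (q - j)) (matLim_hornerDown hF ht (2 * j + 1))).neg
    rwa [zero_pow (by omega), zero_smul, neg_zero] at this

theorem exists_biproper_diagLast_of_det_ne_zero (hm : 0 < m) (ham : (a m).det ≠ 0) :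
    ∃ O K : Matrix (Fin m × Fin n) (Fin m × Fin n) (RatFunc ℂ), IsBiproper O ∧ IsBiproper K ∧
      O * compRingEquiv (Fin m) (Fin n) (RatFunc ℂ) (ofLevels m (theta m 1 t F)) * K =
        diagLast m (hornerDown t F m) := by
  obtain ⟨p₀, hp₀⟩ : ∃ p₀ : Fin m, (p₀.rev : ℕ) = 0 := ⟨Fin.rev ⟨0, hm⟩, by simp⟩
  have hΘ : IsBiproper (compRingEquiv (Fin m) (Fin n) (RatFunc ℂ) (ofLevels m (theta m 1 t F))) :=
    isBiproper_iff.2 ⟨_, det_comp_theta_ne_zero hm ham,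
      matLim_comp fun p q => matLim_theta hF ht p.rev q.rev⟩
  have hdiag : IsBiproper (diagLast m (hornerDown t F m)) := by
    refine isBiproper_iff.2 ⟨diagLast m (a m), ?_, ?_⟩
    · rw [diagLast_eq p₀ hp₀, det_compRingEquiv_diagonal, Finset.prod_ne_zero_iff]
      intro p _
      split_ifs
      exacts [ham, by simp]
    · rw [diagLast_eq p₀ hp₀, diagLast_eq p₀ hp₀]
      refine matLim_comp fun p q => ?_
      rw [diagonal_apply, diagonal_apply]
      split_ifs
      exacts [matLim_hornerDown hF ht m, MatLim.one, MatLim.zero]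
  refine ⟨diagLast m (hornerDown t F m) * _⁻¹, 1, hdiag.mul hΘ.inv,
    isBiproper_iff.2 ⟨1, by simp, MatLim.one⟩, ?_⟩
  rw [Matrix.mul_one, Matrix.mul_assoc, nonsing_inv_mul _ hΘ.isUnit_det, Matrix.mul_one]

theorem exists_biproper_diagLast_of_odd (hm : Odd m) :
    ∃ O K : Matrix (Fin m × Fin n) (Fin m × Fin n) (RatFunc ℂ), IsBiproper O ∧ IsBiproper K ∧
      O * compRingEquiv (Fin m) (Fin n) (RatFunc ℂ) (ofLevels m (theta m 1 t F)) * K =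
        diagLast m (hornerDown t F m) := by
  obtain ⟨p₀, hp₀⟩ : ∃ p₀ : Fin m, (p₀.rev : ℕ) = 0 := ⟨Fin.rev ⟨0, hm.pos⟩, by simp⟩
  obtain ⟨p₁, hp₁⟩ : ∃ p₁ : Fin m, (p₁.rev : ℕ) + 1 = m :=
    ⟨⟨0, hm.pos⟩, by rw [Fin.val_rev]; exact Nat.sub_add_cancel hm.pos⟩
  have hlevel : ∀ p : Fin m, p = p₁ ↔ (p.rev : ℕ) + 1 = m := fun p => by
    rw [← Fin.rev_inj, Fin.ext_iff]
    omega
  obtain ⟨q, rfl⟩ := hm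
  set Y := updateCol (ofLevels (2 * q + 1) (theta (2 * q + 1) 1 t F)) p₁ (Pi.single p₁ 1)
  set f : Fin (2 * q + 1) → Matrix (Fin n) (Fin n) (RatFunc ℂ) := fun p => colDown t F q p.rev
  have hYbi : IsBiproper (compRingEquiv _ (Fin n) (RatFunc ℂ) Y) :=
    isBiproper_iff.2 ⟨_, det_updateCol_theta_of_odd_ne_zero ⟨q, rfl⟩ hp₁, matLim_comp_updateCol
      (fun p q => matLim_theta hF ht p.rev q.rev) p₁ fun p => by
        simpa only [Pi.single_apply] using matLim_ite (p = p₁)⟩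
  have hVbi : IsBiproper (compRingEquiv _ (Fin n) (RatFunc ℂ) (updateCol 1 p₁ f)) :=
    isBiproper_iff.2 ⟨_, (isUnit_det_updateCol_one (fun p => if (p.rev : ℕ) = 2 * q then 1 else 0)
      p₁ (if_pos (by omega))).ne_zero, matLim_comp_updateCol
      (fun p q => by simpa only [one_apply] using matLim_ite (p = q)) p₁ fun p =>
        matLim_colDown hF ht p.rev.2⟩
  have hmul : ofLevels (2 * q + 1) (theta (2 * q + 1) 1 t F) * updateCol 1 p₁ f =
      Y * diagonal fun p => if p = p₁ then hornerDown t F (2 * q + 1) else 1 := by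
    refine mul_updateCol_one _ f p₁ _ fun p => ?_
    have hcol := sum_theta_mul_colDown t F p.rev.2
    rw [Finset.sum_range (fun l => theta (2 * q + 1) 1 t F p.rev l * colDown t F q l),
      ← Equiv.sum_comp Fin.revPerm] at hcol
    simp only [hlevel, Nat.add_right_cancel_iff]
    exact hcol
  let σ : Equiv.Perm (Fin (2 * q + 1) × Fin n) := (Equiv.swap p₀ p₁).prodCongr (Equiv.refl _)
  refine ⟨_, _, hYbi.inv.submatrix σ 1, hVbi.submatrix 1 σ, ?_⟩
  rw [diagLast_eq_submatrix p₀ hp₀ p₁]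
  refine congrArg (fun M => M.submatrix σ σ) (?_ : (compRingEquiv _ (Fin n) (RatFunc ℂ) Y)⁻¹ *
    compRingEquiv _ (Fin n) (RatFunc ℂ) (ofLevels (2 * q + 1) (theta (2 * q + 1) 1 t F)) *
    compRingEquiv _ (Fin n) (RatFunc ℂ) (updateCol 1 p₁ f) = compRingEquiv _ (Fin n) (RatFunc ℂ)
      (diagonal fun p => if p = p₁ then hornerDown t F (2 * q + 1) else 1))
  rw [Matrix.mul_assoc, ← map_mul, hmul, map_mul, ← Matrix.mul_assoc,
    nonsing_inv_mul _ hYbi.isUnit_det, Matrix.one_mul]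

end StructureAtInfinity

section Linearization
variable {m n r : ℕ} (a : ℕ → Matrix (Fin n) (Fin n) ℂ)

theorem hornerUp_cPoly : hornerUp m (X : ℂ[X]) (fun j => cPoly (a j)) 0 = matPoly m a := by
  simp only [hornerUp, matPoly, Nat.sub_zero, zero_add]

theorem hornerDown_cRat : hornerDown (RatFunc.X : RatFunc ℂ)⁻¹ (fun j => cRat (a j)) m =
    (RatFunc.X : RatFunc ℂ)⁻¹ ^ m • polyToRat (matPoly m a) := by
  rw [hornerDown, matPoly, polyToRat_sum, Finset.smul_sum]
  refine Finset.sum_congr rfl fun i hi => ?_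
  rw [polyToRat_X_pow_smul, polyToRat_cPoly, smul_smul,
    pow_sub₀ _ (inv_ne_zero RatFunc.X_ne_zero) (Nat.lt_succ_iff.1 (Finset.mem_range.1 hi)),
    inv_pow _ i, inv_inv]

variable (m) in
/-- The pencil `λ 𝒪 - ℰ` of the factorization `L_P = N (λ 𝒪 - ℰ) D Nᵀ`; it depends on neither `h`
nor the index tuples. -/
noncomputable def corePencil : Matrix (Fin m × Fin n) (Fin m × Fin n) ℂ[X] :=
  compRingEquiv (Fin m) (Fin n) ℂ[X] (ofLevels m (theta m (X : ℂ[X]) 1 fun j => cPoly (a j)))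

theorem corePencil_eq_X_smul_sub :
    corePencil m a =
      (X : ℂ[X]) • cPoly (compRingEquiv (Fin m) (Fin n) ℂ (ofLevels m (theta m (1 : ℂ) 0 a))) -
        cPoly (compRingEquiv (Fin m) (Fin n) ℂ (ofLevels m (theta m (0 : ℂ) (-1) a))) := by
  have h := smul_map_theta_sub (m := m) Polynomial.C (X : ℂ[X]) 1 a
  rw [one_smul] at h
  exact h.symm

theorem X_inv_smul_polyToRat_corePencil :
    (RatFunc.X : RatFunc ℂ)⁻¹ • polyToRat (corePencil m a) =
    compRingEquiv (Fin m) (Fin n) (RatFunc ℂ)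
      (ofLevels m (theta m 1 (RatFunc.X : RatFunc ℂ)⁻¹ fun j => cRat (a j))) := by
  refine Eq.trans ?_ (smul_map_theta_sub RatFunc.C 1 (RatFunc.X : RatFunc ℂ)⁻¹ a)
  rw [corePencil_eq_X_smul_sub, polyToRat_sub, ← pow_one (X : ℂ[X]), polyToRat_X_pow_smul,
    polyToRat_cPoly, polyToRat_cPoly, pow_one, smul_sub, smul_smul,
    inv_mul_cancel₀ RatFunc.X_ne_zero]
  rfl

theorem properPart_block (A E : Matrix (Fin r) (Fin r) ℂ) (B : Matrix (Fin r) (Fin n) ℂ)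
    (C : Matrix (Fin n) (Fin r) ℂ) (p₀ : Fin m) :
    properPart A (blockRow p₀ B) (blockCol p₀ C) E =
      blockCol p₀ (blockRow p₀ (properPart A B C E)) := by
  unfold properPart cRat
  rw [map_blockCol, map_blockRow, blockCol_mul, blockCol_mul, mul_blockRow]

/-- The coefficients of `G(λ) = P(λ) + C (λ E - A)⁻¹ B` regarded as a polynomial of degree `m` in
`λ` whose constant coefficient is the rational matrix `A₀ + C (λ E - A)⁻¹ B`. -/
noncomputable def ratCoeff (A : Matrix (Fin r) (Fin r) ℂ) (B : Matrix (Fin r) (Fin n) ℂ)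
    (C : Matrix (Fin n) (Fin r) ℂ) (E : Matrix (Fin r) (Fin r) ℂ) :
    ℕ → Matrix (Fin n) (Fin n) (RatFunc ℂ) :=
  Function.update (fun j => cRat (a j)) 0 (cRat (a 0) + properPart A B C E)

theorem hornerDown_ratCoeff (A E : Matrix (Fin r) (Fin r) ℂ) (B : Matrix (Fin r) (Fin n) ℂ)
    (C : Matrix (Fin n) (Fin r) ℂ) :
    hornerDown (RatFunc.X : RatFunc ℂ)⁻¹ (ratCoeff a A B C E) m =
      (RatFunc.X : RatFunc ℂ)⁻¹ ^ m • transferFunction (matPoly m a) A B C E := by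
  rw [transferFunction_eq, smul_add, ← hornerDown_cRat, ← hornerDown_update_zero, ratCoeff]

theorem matLim_ratCoeff (A : Matrix (Fin r) (Fin r) ℂ) (B : Matrix (Fin r) (Fin n) ℂ)
    (C : Matrix (Fin n) (Fin r) ℂ) {E : Matrix (Fin r) (Fin r) ℂ} (hE : E.det ≠ 0) (j : ℕ) :
    MatLim (ratCoeff a A B C E j) (a j) := by
  unfold ratCoeff
  obtain rfl | hj := eq_or_ne j 0
  · rw [Function.update_self]
    simpa only [add_zero] using (matLim_cRat (a 0)).add (matLim_properPart A B C hE)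
  · rw [Function.update_of_ne hj]
    exact matLim_cRat (a j)

theorem isUnimodular_of_isUnit_det {ι : Type} [Fintype ι] [DecidableEq ι] {U : Matrix ι ι ℂ[X]}
    (h : IsUnit U.det) : IsUnimodular U := by
  obtain ⟨c, hc, h⟩ := Polynomial.isUnit_iff.1 h
  exact ⟨c, hc.ne_zero, h.symm⟩

theorem isUnit_det_cPoly {ι : Type} [Fintype ι] [DecidableEq ι] {N : Matrix ι ι ℂ}
    (hN : N.det ≠ 0) : IsUnit (cPoly N).det := by
  rw [cPoly, ← RingHom.mapMatrix_apply, ← RingHom.map_det]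
  exact hN.isUnit.map _

variable {N₁ N₂ : Matrix (Fin m × Fin n) (Fin m × Fin n) ℂ}
  (A E : Matrix (Fin r) (Fin r) ℂ) (B : Matrix (Fin r) (Fin n) ℂ) (C : Matrix (Fin n) (Fin r) ℂ)
  {p₀ : Fin m} (hp₀ : (p₀.rev : ℕ) = 0)
include hp₀

variable (N₁ N₂) in
theorem X_inv_smul_transferFunction :
    (RatFunc.X : RatFunc ℂ)⁻¹ • transferFunction (cPoly N₁ * corePencil m a * cPoly N₂) A
        (blockRow p₀ B * N₂) (N₁ * blockCol p₀ C) E =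
    cRat N₁ * compRingEquiv (Fin m) (Fin n) (RatFunc ℂ)
      (ofLevels m (theta m 1 (RatFunc.X : RatFunc ℂ)⁻¹ (ratCoeff a A B C E))) * cRat N₂ := by
  rw [ratCoeff, comp_theta_update_zero hp₀, ← X_inv_smul_polyToRat_corePencil, ← properPart_block,
    ← smul_add, transferFunction_eq, polyToRat_mul, polyToRat_mul, polyToRat_cPoly,
    polyToRat_cPoly, Matrix.mul_smul, Matrix.smul_mul]
  unfold properPart
  simp only [cRat_mul, Matrix.mul_add, Matrix.add_mul, Matrix.mul_assoc]

variable (h₁ : N₁.det ≠ 0) (h₂ : N₂.det ≠ 0)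
include h₁ h₂

theorem exists_unimodular_systemMatrix :
    ∃ U V : Matrix (Fin m × Fin n) (Fin m × Fin n) ℂ[X], IsUnimodular U ∧ IsUnimodular V ∧
      fromBlocks U 0 0 1 *
        systemMatrix (cPoly N₁ * corePencil m a * cPoly N₂) A
          (blockRow p₀ B * N₂) (N₁ * blockCol p₀ C) E * fromBlocks V 0 0 1 =
        systemMatrix (diagLast m (matPoly m a)) A (blockRow p₀ B) (blockCol p₀ C) E := by
  obtain ⟨U, V, hU, hV, hUV, hUc, hVr⟩ :=
    exists_equiv_diagLast p₀ (X : ℂ[X]) (fun j => cPoly (a j)) hp₀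
  have hN₁ := isUnit_det_cPoly h₁
  have hN₂ := isUnit_det_cPoly h₂
  refine ⟨U * (cPoly N₁)⁻¹, (cPoly N₂)⁻¹ * V, isUnimodular_of_isUnit_det ?_,
    isUnimodular_of_isUnit_det ?_, ?_⟩
  · rw [det_mul]
    exact hU.mul (isUnit_nonsing_inv_det _ hN₁)
  · rw [det_mul]
    exact (isUnit_nonsing_inv_det _ hN₂).mul hV
  · have hcol : cPoly (blockCol p₀ C) = blockCol p₀ (cPoly C) := map_blockCol p₀ _ C
    have hrow : cPoly (blockRow p₀ B) = blockRow p₀ (cPoly B) := map_blockRow p₀ _ B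
    rw [hornerUp_cPoly, ← corePencil] at hUV
    unfold systemMatrix
    rw [cPoly_mul, cPoly_mul, hcol, hrow, fromBlocks_multiply, fromBlocks_multiply]
    simp only [Matrix.mul_zero, Matrix.zero_mul, add_zero, zero_add, Matrix.one_mul,
      Matrix.mul_one, Matrix.mul_assoc, nonsing_inv_mul_cancel_left _ _ hN₁,
      mul_nonsing_inv_cancel_left _ _ hN₂]
    rw [← Matrix.mul_assoc U, hUV, hUc, hVr]

theorem exists_biproper_transferFunction (hE : E.det ≠ 0) (ham : Odd m ∨ (a m).det ≠ 0) :
    ∃ O K : Matrix (Fin m × Fin n) (Fin m × Fin n) (RatFunc ℂ), IsBiproper O ∧ IsBiproper K ∧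
      O * ((RatFunc.X : RatFunc ℂ)⁻¹ •
        transferFunction (cPoly N₁ * corePencil m a * cPoly N₂) A
          (blockRow p₀ B * N₂) (N₁ * blockCol p₀ C) E) * K =
        diagLast m ((RatFunc.X : RatFunc ℂ)⁻¹ ^ m • transferFunction (matPoly m a) A B C E) := by
  have hF := matLim_ratCoeff a A B C hE
  obtain ⟨O, K, hO, hK, hOK⟩ := ham.elim (exists_biproper_diagLast_of_odd hF HasLim.X_inv)
    (exists_biproper_diagLast_of_det_ne_zero hF HasLim.X_inv (Fin.pos p₀))
  have hN₁ := IsBiproper.cRat h₁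
  have hN₂ := IsBiproper.cRat h₂
  refine ⟨O * (cRat N₁)⁻¹, (cRat N₂)⁻¹ * K, hO.mul hN₁.inv, hN₂.inv.mul hK, ?_⟩
  rw [X_inv_smul_transferFunction a N₁ N₂ A E B C hp₀, ← hornerDown_ratCoeff, ← hOK]
  simp only [Matrix.mul_assoc, nonsing_inv_mul_cancel_left _ _ hN₁.isUnit_det,
    mul_nonsing_inv_cancel_left _ _ hN₂.isUnit_det]

theorem isRosenbrockStrongLinearization_of_strictEquiv (ham : Odd m ∨ (a m).det ≠ 0)
    {G : Matrix (Fin n) (Fin n) (RatFunc ℂ)}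
    (hmin : IsMinimalRealization G (matPoly m a) A B C E) {p : Fin m}
    (hC : N₁ * blockCol p₀ C = blockCol p C) (hB : blockRow p₀ B * N₂ = blockRow p B) :
    IsRosenbrockStrongLinearization
      (systemMatrix (cPoly N₁ * corePencil m a * cPoly N₂) A (blockRow p B) (blockCol p C) E)
      G (matPoly m a) A B C E := by
  set L := cPoly N₁ * corePencil m a * cPoly N₂ with hL
  obtain ⟨X₁, Y₁, hXY⟩ : ∃ X₁ Y₁, L = cPoly X₁ - (X : ℂ[X]) • cPoly Y₁ := by
    refine ⟨-(N₁ * compRingEquiv (Fin m) (Fin n) ℂ (ofLevels m (theta m (0 : ℂ) (-1) a)) * N₂),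
      -(N₁ * compRingEquiv (Fin m) (Fin n) ℂ (ofLevels m (theta m (1 : ℂ) 0 a)) * N₂), ?_⟩
    rw [hL, corePencil_eq_X_smul_sub, cPoly_neg, cPoly_neg, cPoly_mul, cPoly_mul,
      cPoly_mul, cPoly_mul, Matrix.mul_sub, Matrix.sub_mul, Matrix.mul_smul, Matrix.smul_mul,
      smul_neg, neg_sub_neg]
  have hcol : colKron m m C = blockCol p₀ C := colKron_self_eq_blockCol hp₀ C
  have hrow : rowKron m m B = blockRow p₀ B := rowKron_self_eq_blockRow hp₀ B
  obtain ⟨U, V, hU, hV, hUV⟩ := exists_unimodular_systemMatrix a A E B C hp₀ h₁ h₂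
  have hbiproper := exists_biproper_transferFunction a A E B C hp₀ h₁ h₂ hmin.1.1 ham
  rw [hC, hB, ← hL] at hUV hbiproper
  rw [← hmin.1.2] at hbiproper
  rw [hXY] at *
  exact ⟨X₁, Y₁, blockCol p C, blockRow p B, A, E, _, rfl, rfl,
    isMinimalRealization_of_block hmin _ p,
    ⟨U, V, 1, 1, hU, hV, by simp, by simp, by rw [cPoly_one, hrow, hcol, hUV]⟩, hbiproper⟩

end Linearization

section Main
variable {m n r h : ℕ} (a : ℕ → Matrix (Fin n) (Fin n) ℂ)

theorem exists_rev_eq_inversionsAt (hh : Even h) (hm : h < m) {tw : List ℤ}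
    (htw : IsCanonical h tw) :
    ∃ p : Fin m, (p.rev : ℤ) = inversionsAt 0 (tw ++ simpleTuple h) := by
  obtain ⟨s, hs, -, -, -, -, hα, hαh⟩ := exists_track_altTuple hh htw
  have hsα := le_track s tw
  rw [hα] at hsα hαh
  obtain ⟨k, hk⟩ := Int.eq_ofNat_of_zero_le (hs.trans hsα)
  exact ⟨Fin.rev ⟨k, by omega⟩, by rw [Fin.rev_rev, hk]⟩

theorem pencilS_isRosenbrockStrongLinearization (hh : Even h) (hm : h < m) {tw tv : List ℤ}
    (htw : IsCanonical h tw) (htv : IsCanonical (m - h - 1) (shift m tv))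
    {𝒳 𝒴 : List (Matrix (Fin n) (Fin n) ℂ)} (h𝒳 : IsNonsingularAssignment m tw 𝒳)
    (h𝒴 : IsNonsingularAssignment m tv 𝒴) (h𝒳s : ∀ M ∈ 𝒳, M.IsSymm) (h𝒴s : ∀ M ∈ 𝒴, M.IsSymm)
    (ha : ∀ j ≤ m, (a j).IsSymm) (ham : Odd m ∨ (a m).det ≠ 0)
    {G : Matrix (Fin n) (Fin n) (RatFunc ℂ)} {A E : Matrix (Fin r) (Fin r) ℂ}
    {B : Matrix (Fin r) (Fin n) ℂ} {C : Matrix (Fin n) (Fin r) ℂ}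
    (hmin : IsMinimalRealization G (matPoly m a) A B C E) :
    IsRosenbrockStrongLinearization (pencilS m h a A B C E tw tv 𝒳 𝒴) G (matPoly m a) A B C E := by
  obtain ⟨p, hp⟩ := exists_rev_eq_inversionsAt hh hm htw
  obtain ⟨p₀, hp₀⟩ : ∃ p₀ : Fin m, (p₀.rev : ℕ) = 0 := ⟨Fin.rev ⟨0, by omega⟩, by simp⟩
  have hcol := congruenceFactor_mul_colKron a hm hh htw htv h𝒳.1 h𝒴.1 C
  have hrow := rowKron_mul_leadTuple_mul a hm hh htw htv h𝒳.1 h𝒴.1 ha B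
  have hK := det_congruenceFactor_ne_zero (h := h) a h𝒳 h𝒴
  have hD := det_prodP_leadTuple_ne_zero a (by omega) fun he =>
    ham.resolve_left (Nat.not_odd_iff_even.2 he)
  rw [← hp, colKron_self_eq_blockCol hp₀, colKron_eq_blockCol] at hcol
  rw [← hp, rowKron_self_eq_blockRow hp₀, rowKron_eq_blockRow] at hrow
  rw [pencilS_eq_systemMatrix a hm hh htw htv h𝒳.1 h𝒴.1 ha h𝒳s h𝒴s,
    pencilP_eq a hm hh h𝒳.1 h𝒴.1 ha h𝒳s h𝒴s, fiedlerP_mul_prodP_oddTuple a hh hm,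
    prodP_evenTuple a hh hm, ← corePencil_eq_X_smul_sub, ← hp, colKron_eq_blockCol,
    rowKron_eq_blockRow]
  refine isRosenbrockStrongLinearization_of_strictEquiv a A E B C hp₀ hK ?_ ham hmin hcol hrow
  rw [det_mul, det_transpose]
  exact mul_ne_zero hD hK

end Main

end RosenbrockGFPR

theorem corollary4p7 (m n r h : ℕ)
    -- `P(λ) = ∑_{j=0}^m λ^j A_j` with `A_j = a j` and `A_m ≠ 0`
    (a : ℕ → Matrix (Fin n) (Fin n) ℂ) (ham : a m ≠ 0)
    -- `G(λ) = P(λ) + Bᵀ (λ E - A)⁻¹ B` is symmetric, with a minimal symmetric realization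
    (A E : Matrix (Fin r) (Fin r) ℂ) (B : Matrix (Fin r) (Fin n) ℂ)
    (hA : A.IsSymm) (hE : E.IsSymm)
    (G : Matrix (Fin n) (Fin n) (RatFunc ℂ)) (hG : G.IsSymm)
    (hmin : IsMinimalRealization G (matPoly m a) A B Bᵀ E)
    -- `0 ≤ h ≤ m - 1` is even
    (hh : Even h) (hm : h < m)
    -- `t_w` and `t_v + m` are in canonical form for `h` and `m - h - 1`
    (tw tv : List ℤ) (htw : IsCanonical h tw) (htv : IsCanonical (m - h - 1) (shift m tv))
    -- nonsingular matrix assignments consisting of symmetric matrices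
    (𝒳 𝒴 : List (Matrix (Fin n) (Fin n) ℂ))
    (h𝒳 : IsNonsingularAssignment m tw 𝒳) (h𝒴 : IsNonsingularAssignment m tv 𝒴)
    (h𝒳s : ∀ M ∈ 𝒳, M.IsSymm) (h𝒴s : ∀ M ∈ 𝒴, M.IsSymm)
    (α : ℤ) (hα : α = inversionsAt 0 (tw ++ simpleTuple h))
    (𝕃 : Matrix ((Fin m × Fin n) ⊕ Fin r) ((Fin m × Fin n) ⊕ Fin r) ℂ[X])
    (h𝕃 : 𝕃 = pencilS m h a A B Bᵀ E tw tv 𝒳 𝒴) :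
    -- the block form of `𝕃(λ)`
    𝕃 = systemMatrix (pencilP m h a tw tv 𝒳 𝒴) A (rowKron m (m - α) B) (colKron m (m - α) Bᵀ) E ∧
    -- `𝕃(λ)` is symmetric, and it is a Rosenbrock strong linearization of `G(λ)`
    𝕃.IsSymm ∧
    (Odd m → IsRosenbrockStrongLinearization 𝕃 G (matPoly m a) A B Bᵀ E) ∧
    (Even m → (a m).det ≠ 0 →
      IsRosenbrockStrongLinearization 𝕃 G (matPoly m a) A B Bᵀ E) ∧
    -- the transfer function of `𝕃(λ)` is symmetric
    (transferFunction (pencilP m h a tw tv 𝒳 𝒴) A (rowKron m (m - α) B)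
      (colKron m (m - α) Bᵀ) E).IsSymm := by
  subst h𝕃 hα
  obtain rfl := hmin.1.2
  have ha := fun j hj =>
    isSymm_of_matPoly (isSymm_of_transferFunction hA hE B hG) (j := j) hj
  have hblock := pencilS_eq_systemMatrix a hm hh htw htv h𝒳.1 h𝒴.1 ha h𝒳s h𝒴s A E B Bᵀ
  have hsymm := pencilP_isSymm a hm hh h𝒳.1 h𝒴.1 ha h𝒳s h𝒴s
  have hlin (hns : Odd m ∨ (a m).det ≠ 0) :=
    pencilS_isRosenbrockStrongLinearization a hh hm htw htv h𝒳 h𝒴 h𝒳s h𝒴s ha hns hmin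
  refine ⟨hblock, ?_, fun hodd => hlin (.inl hodd), fun _ hdet => hlin (.inr hdet),
    transferFunction_isSymm hA hE hsymm _⟩
  rw [hblock]
  exact systemMatrix_isSymm hA hE hsymm (rowKron m _ B)
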